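/- All graphs are finite and simple. Let $G=(V,E)$ be a graph on $n=|V|$ vertices. A \emph{tree decomposition} of $G$ is a finite tree $T$ together with a bag $B_u\subseteq V$ for every node $u$ of $T$, such that for every edge $xy$ of $G$ some bag contains both $x$ and $y$, and for every vertex $x\in V$ the set of nodes $u$ with $x\in B_u$ induces a non-empty subtree of $T$. The \emph{size} of the tree decomposition is $\max_u |B_u|-1$, and the \emph{treewidth} $tw(G)$ is the minimum size of a tree decomposition of $G$. For an integer $k\ge 0$, a \emph{$k$-colouring} of $G$ is a map $f:V\to\{1,\dots,k\}$ with $f(x)\ne f(y)$ for every edge $xy$. The \emph{$k$-recolouring graph} $R_k(G)$ has the $k$-colourings of $G$ as its vertices, two of them being adjacent if they differ on exactly one vertex of $G$. The graph $G$ is \emph{$k$-mixing} if $R_k(G)$ is connected (in particular non-empty), and the \emph{$k$-recolouring diameter} of $G$ is the diameter of $R_k(G)$. \textbf{Theorem.} For every graph $G$ and every integer $k\ge tw(G)+2$, the graph $G$ is $k$-mixing and its $k$-recolouring diameter is at most $2(n^2+n)$. -/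

import Mathlib

/-- A tree decomposition of `G` whose nodes are the elements of `N`: a tree on `N` together with a
bag of vertices for every node. -/
structure TreeDecomposition {V : Type*} (G : SimpleGraph V) (N : Type*) where
  /-- The underlying tree. -/
  tree : SimpleGraph N
  isTree : tree.IsTree
  /-- The bag of a node. -/
  bag : N → Finset V
  /-- Both ends of every edge lie in a common bag. -/
  exists_bag_of_adj : ∀ x y : V, G.Adj x y → ∃ u : N, x ∈ bag u ∧ y ∈ bag u
  /-- The nodes whose bags contain `x` induce a non-empty connected subgraph of the tree, that is,
  a non-empty subtree (`SimpleGraph.Connected` includes non-emptiness). -/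
  connected_nodes : ∀ x : V, (tree.induce {u : N | x ∈ bag u}).Connected

/-- The size of a tree decomposition: the largest number of vertices in a bag, minus one. It is an
integer: it equals `-1` when all bags are empty. -/
def TreeDecomposition.size {V : Type*} {G : SimpleGraph V} {N : Type*} [Fintype N]
    (T : TreeDecomposition G N) : ℤ :=
  ((Finset.univ.sup fun u : N => (T.bag u).card : ℕ) : ℤ) - 1

/-- The integers that are the size of some tree decomposition of `G`. Every finite tree is
isomorphic to one whose set of nodes is some `Fin m`. -/
def treeDecompositionSizes {V : Type*} (G : SimpleGraph V) : Set ℤ :=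
  {s : ℤ | ∃ (m : ℕ) (T : TreeDecomposition G (Fin m)), T.size = s}

/-- The treewidth of a finite graph: the minimum size of a tree decomposition. -/
noncomputable def treewidth {V : Type*} [Finite V] (G : SimpleGraph V) : ℤ :=
  sInf (treeDecompositionSizes G)

/-- The minimum in the definition of the treewidth exists and is attained. -/
theorem treewidth_isLeast {V : Type*} [Finite V] (G : SimpleGraph V) :
    IsLeast (treeDecompositionSizes G) (treewidth G) := by
  have hne : (treeDecompositionSizes G).Nonempty := by
    have := Fintype.ofFinite V
    refine ⟨_, 1, ⟨⊥, SimpleGraph.IsTree.of_subsingleton, fun _ => Finset.univ,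
      fun x y _ => ⟨0, by simp⟩, fun x => ?_⟩, rfl⟩
    have : Nonempty {u : Fin 1 | x ∈ (Finset.univ : Finset V)} := ⟨⟨0, by simp⟩⟩
    exact SimpleGraph.IsTree.of_subsingleton.connected
  have hbdd : BddBelow (treeDecompositionSizes G) := by
    refine ⟨-1, ?_⟩
    rintro s ⟨m, T, rfl⟩
    unfold TreeDecomposition.size
    omega
  exact ⟨Int.csInf_mem hne hbdd, fun s hs => csInf_le hbdd hs⟩

/-- The `k`-recoloring graph of `G`: its vertices are the proper `k`-colorings of `G`, two of them
being adjacent if they differ on exactly one vertex of `G`. -/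
def recoloringGraph {V : Type*} (G : SimpleGraph V) (k : ℕ) :
    SimpleGraph (G.Coloring (Fin k)) where
  Adj α β := ∃! v : V, α v ≠ β v
  symm := ⟨fun α β h => by simpa only [ne_comm] using h⟩
  loopless := ⟨fun α h => by
    obtain ⟨v, hv, -⟩ := h
    exact hv rfl⟩

/-- `G` is `k`-mixing if its `k`-recoloring graph is connected (in particular, it is non-empty). -/
def IsMixing {V : Type*} (G : SimpleGraph V) (k : ℕ) : Prop :=
  (recoloringGraph G k).Connected

/-- The `k`-recoloring diameter of `G`: the diameter of its `k`-recoloring graph, infinite if the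
distances between colorings are not bounded. -/
noncomputable def recoloringDiameter {V : Type*} (G : SimpleGraph V) (k : ℕ) : ℕ∞ :=
  (recoloringGraph G k).ediam

/-! Let `b` be the largest bag size, so that `b < k`. A greedy pass over the tree gives every vertex
one of `b` types, distinct within each bag, hence distinct for adjacent vertices. Any injection of
types into colors is then a coloring of `G`. Every coloring is brought to this form in at most n²
steps, and two colorings of this form are at most 2n steps apart because a spare color allows the
colors of the types to be permuted: n² + 2n + n² in all.

To reach this form, vertices are forgotten along the decomposition, and only the set `D` of
forgotten vertices, separated from the rest by the current bag `K`, is recolored. The invariant is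
that the color of a forgotten vertex `w` depends only on its slot. If no vertex of `K` has the type
of `w`, the slot is that type. If `y` in `K` has this type, `w` should take the color of `y`; but
several vertices of `K` may share that color, while their types must still be told apart. So the
vertices of one color are ranked by age: the oldest lends its own color, each younger one lends an
extra color. Whatever the coloring of `K`, there are exactly as many active slots as types, so some
color is always free. Branches meeting at a join may have introduced the vertices of `K` in
different orders, so the age order `O` is recorded separately for each forgotten vertex.

Introducing a vertex costs at most |D| steps (`exists_edist_introduce_le`), forgetting one at most
|D| + 1 (`exists_edist_forget_le`), and a join at most 2|D₂| to reconcile the palettes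
(`edist_slotColoring_le`). These add up to |D|(|D| + |K|) in `Region.exists_edist_le`, which is n²
once everything is forgotten (`TreeDecomposition.region_univ`). -/

open Finset

/-! ### Recoloring every vertex at most once -/

section Recoloring

variable {V : Type*} {G : SimpleGraph V} {k : ℕ}

/-- Two colorings can be joined by recoloring once every vertex on which they differ, in an order
of increasing priority `ρ`, if no vertex takes a color that a neighbor of higher or equal priority
has initially. -/
theorem edist_recoloringGraph_le_of_priority [Fintype V] (ρ : V → ℕ) (f g : G.Coloring (Fin k))
    (h : ∀ x y, G.Adj x y → ρ x ≤ ρ y → g x ≠ f y) :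
    (recoloringGraph G k).edist f g ≤ (#{x | f x ≠ g x} : ℕ) := by
  classical
  induction hn : #{x | f x ≠ g x} generalizing f with
  | zero =>
    have : f = g := by
      ext x
      simp only [card_eq_zero, filter_eq_empty_iff, mem_univ, true_implies, not_not] at hn
      rw [hn]
    simp [this]
  | succ n ih =>
    obtain ⟨x, hx, hmin⟩ := exists_min_image ({x | f x ≠ g x} : Finset V) ρ
      (card_pos.1 (by omega))
    have hx' : f x ≠ g x := by simpa using hx
    -- A neighbor of `x` either has its final color already, or still has to change and then has
    -- priority at least that of `x`.
    have hnew : ∀ y, G.Adj x y → g x ≠ f y := fun y hxy => by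
      by_cases hy : f y = g y
      · rw [hy]; exact g.valid hxy
      · exact h x y hxy (hmin y (by simpa using hy))
    let f' : G.Coloring (Fin k) := SimpleGraph.Coloring.mk (Function.update f x (g x)) (by
      intro y z hyz
      rcases eq_or_ne y x with rfl | hy
      · rw [Function.update_self, Function.update_of_ne hyz.ne']
        exact hnew z hyz
      · rcases eq_or_ne z x with rfl | hz
        · rw [Function.update_self, Function.update_of_ne hy]
          exact (hnew y hyz.symm).symm
        · rw [Function.update_of_ne hy, Function.update_of_ne hz]
          exact f.valid hyz)
    have hf' : ∀ y, f' y = Function.update f x (g x) y := fun y => rfl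
    have hf'x : f' x = g x := by rw [hf', Function.update_self]
    have hf'ne : ∀ y, y ≠ x → f' y = f y := fun y hy => by rw [hf', Function.update_of_ne hy]
    have hadj : (recoloringGraph G k).Adj f f' := by
      refine ⟨x, by simpa [hf'x] using hx', fun y hy => ?_⟩
      by_contra hyx
      exact hy (hf'ne y hyx).symm
    have hcard : #{y | f' y ≠ g y} = n := by
      have : ({y | f' y ≠ g y} : Finset V) = ({y | f y ≠ g y} : Finset V).erase x := by
        ext y
        rcases eq_or_ne y x with rfl | hy
        · simp [hf'x]
        · simp [hf'ne y hy, hy]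
      rw [this, card_erase_of_mem hx, hn, Nat.add_sub_cancel]
    have hrec := ih f' (fun y z hyz hρ => by
      rcases eq_or_ne z x with rfl | hz
      · rw [hf'x]; exact g.valid hyz
      · rw [hf'ne z hz]; exact h y z hyz hρ) hcard
    calc (recoloringGraph G k).edist f g
        ≤ (recoloringGraph G k).edist f f' + (recoloringGraph G k).edist f' g :=
          SimpleGraph.edist_triangle
      _ ≤ 1 + n := add_le_add (SimpleGraph.edist_eq_one_iff_adj.2 hadj).le hrec
      _ = ((n + 1 : ℕ) : ℕ∞) := by push_cast; rw [add_comm]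

end Recoloring

/-- An injective function on a set can be changed outside of it so as to become injective on a
larger set, if the target is large enough. -/
theorem exists_injOn_extension {α β : Type*} [DecidableEq α] [Fintype β] (s t : Finset α)
    (hst : s ⊆ t) (f : α → β) (hf : Set.InjOn f s) (ht : #t ≤ Fintype.card β) :
    ∃ g : α → β, (∀ x, x ∈ s ∨ x ∉ t → g x = f x) ∧ Set.InjOn g t := by
  classical
  induction hn : #(t \ s) generalizing s f with
  | zero =>
    have : t ⊆ s := by simpa using hn
    exact ⟨f, fun _ _ => rfl, hf.mono (by exact_mod_cast this)⟩
  | succ n ih =>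
    obtain ⟨x, hx⟩ : (t \ s).Nonempty := card_pos.1 (by omega)
    obtain ⟨hxt, hxs⟩ := mem_sdiff.1 hx
    obtain ⟨c, hc⟩ : ∃ c, c ∉ s.image f := by
      by_contra! hall
      have h1 : #(s.image f) = Fintype.card β := by
        rw [eq_univ_iff_forall.2 hall, card_univ]
      have h2 : #s < #t := card_lt_card ⟨hst, fun h => hxs (h hxt)⟩
      have := card_image_le (s := s) (f := f)
      omega
    have hne : ∀ y ∈ s, y ≠ x := fun y hy h => hxs (h ▸ hy)
    obtain ⟨g, hg, hinj⟩ := ih (insert x s) (insert_subset hxt hst) (Function.update f x c) (by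
      rw [coe_insert, Set.injOn_insert (by exact_mod_cast hxs)]
      refine ⟨fun y hy z hz hyz => ?_, ?_⟩
      · rw [Function.update_of_ne (hne y hy), Function.update_of_ne (hne z hz)] at hyz
        exact hf hy hz hyz
      · rintro ⟨y, hy, hyc⟩
        rw [Function.update_self, Function.update_of_ne (hne y hy)] at hyc
        exact hc (mem_image.2 ⟨y, hy, hyc⟩)) (by
      rw [sdiff_insert, card_erase_of_mem hx]; omega)
    refine ⟨g, fun y hy => ?_, hinj⟩
    have hyx : y ≠ x := by rintro rfl; tauto
    rw [hg y (by simp only [mem_insert]; tauto), Function.update_of_ne hyx]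

/-! ### Slots of a bag and palettes -/

section Slots

variable {V Λ C : Type*} [DecidableEq V] [Fintype Λ] [DecidableEq Λ] [Fintype C] [DecidableEq C]

/-- The slots of a bag: a color together with a rank, or a type. -/
abbrev Slot (Λ C : Type*) := (Σ _ : C, ℕ) ⊕ Λ

/-- The slots in use for the bag `K` colored by `f`: for every color `a`, one slot for each of its
occurrences in `K`, and one slot for every type that does not occur in `K`. -/
def activeSlots (γ : V → Λ) (K : Finset V) (f : V → C) : Finset (Slot Λ C) :=
  (univ.sigma fun a : C => range #{x ∈ K | f x = a}).disjSum (K.image γ)ᶜ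

/-- The slot of a forgotten vertex `w`. If the bag `K` contains a vertex `y` of the type of `w`, it
consists of the color of `y` and of the number of vertices of `K` with that color that are older
than `y` from the viewpoint of `w`, as recorded by `O`. -/
noncomputable def slot (γ : V → Λ) (K : Finset V) (O : V → Finset V) (f : V → C) (w : V) :
    Slot Λ C :=
  open Classical in
  if h : ∃ y ∈ K, γ y = γ w then
    .inl ⟨f h.choose, #{x ∈ K | x ∈ O w ∧ f x = f h.choose}⟩
  else .inr (γ w)

/-- A palette assigns distinct colors to the slots in use, compatibly with the coloring `f` of the
bag `K`. -/
structure IsPalette (γ : V → Λ) (K : Finset V) (f : V → C) (p : Slot Λ C → C) : Prop where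
  injOn : Set.InjOn p (activeSlots γ K f)
  base : ∀ x ∈ K, p (.inl ⟨f x, 0⟩) = f x

variable {γ : V → Λ} {K : Finset V} {O : V → Finset V} {f : V → C} {p : Slot Λ C → C}

omit [Fintype Λ] [Fintype C] in
theorem slot_of_mem (hγ : Set.InjOn γ K) {w y : V} (hy : y ∈ K) (h : γ y = γ w) :
    slot γ K O f w = .inl ⟨f y, #{x ∈ K | x ∈ O w ∧ f x = f y}⟩ := by
  have hex : ∃ y ∈ K, γ y = γ w := ⟨y, hy, h⟩
  have : hex.choose = y := hγ hex.choose_spec.1 hy (hex.choose_spec.2.trans h.symm)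
  rw [slot, dif_pos hex, this]

omit [Fintype Λ] [Fintype C] in
theorem slot_of_forall_ne {w : V} (h : ∀ y ∈ K, γ y ≠ γ w) :
    slot γ K O f w = .inr (γ w) := by
  rw [slot, dif_neg]
  rintro ⟨y, hy, hyw⟩
  exact h y hy hyw

omit [DecidableEq V] in
theorem inl_mem_activeSlots {a : C} {i : ℕ} :
    (.inl ⟨a, i⟩ : Slot Λ C) ∈ activeSlots γ K f ↔ i < #{x ∈ K | f x = a} := by
  simp [activeSlots]

omit [DecidableEq V] in
theorem inr_mem_activeSlots {j : Λ} :
    (.inr j : Slot Λ C) ∈ activeSlots γ K f ↔ ∀ y ∈ K, γ y ≠ j := by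
  simp [activeSlots]

omit [DecidableEq V] in
theorem base_mem_activeSlots {x : V} (hx : x ∈ K) :
    (.inl ⟨f x, 0⟩ : Slot Λ C) ∈ activeSlots γ K f :=
  inl_mem_activeSlots.2 (card_pos.2 ⟨x, by simpa using hx⟩)

omit [DecidableEq V] in
-- The ranks of all colors together number |K|, and exactly |Λ| - |K| types are missing from `K`.
theorem card_activeSlots (hγ : Set.InjOn γ K) : #(activeSlots γ K f) = Fintype.card Λ := by
  rw [activeSlots, card_disjSum, card_sigma, card_compl, card_image_of_injOn hγ]
  simp only [card_range]
  rw [← card_eq_sum_card_fiberwise (fun x _ => mem_coe.2 (mem_univ _))]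
  have : #K ≤ Fintype.card Λ := by
    rw [← card_image_of_injOn hγ]; exact card_le_univ _
  omega

/-- The vertex `y` has its own color but is not older than itself, so its rank is smaller than the
number of occurrences of that color. -/
theorem slot_mem_activeSlots (hγ : Set.InjOn γ K) {w : V}
    (hO : ∀ y ∈ K, γ y = γ w → y ∉ O w) : slot γ K O f w ∈ activeSlots γ K f := by
  by_cases h : ∃ y ∈ K, γ y = γ w
  · obtain ⟨y, hy, hyw⟩ := h
    rw [slot_of_mem hγ hy hyw, inl_mem_activeSlots]
    refine card_lt_card ⟨fun x hx => ?_, fun hsub => ?_⟩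
    · simp only [mem_filter] at hx ⊢; exact ⟨hx.1, hx.2.2⟩
    · have := hsub (show y ∈ _ by simpa using hy)
      simp only [mem_filter] at this
      exact hO y hy hyw this.2.1
  · push Not at h
    rw [slot_of_forall_ne h, inr_mem_activeSlots]
    exact h

omit [DecidableEq V] in
-- The spare color, available for every coloring of the bag, is what one color more than types buys;
-- the moves below rest on it.
theorem exists_notMem_image_activeSlots (hγ : Set.InjOn γ K)
    (hC : Fintype.card Λ < Fintype.card C) : ∃ c, c ∉ (activeSlots γ K f).image p := by
  by_contra! hall
  have h1 : #((activeSlots γ K f).image p) = Fintype.card C := by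
    rw [eq_univ_iff_forall.2 hall, card_univ]
  have h2 := card_image_le (s := activeSlots γ K f) (f := p)
  rw [card_activeSlots hγ] at h2
  omega

omit [DecidableEq V] in
theorem exists_isPalette (hγ : Set.InjOn γ K) (hC : Fintype.card Λ < Fintype.card C) :
    ∃ p, IsPalette γ K f p := by
  classical
  have : Nonempty C := Fintype.card_pos_iff.1 (by omega)
  obtain ⟨p, hp, hinj⟩ := exists_injOn_extension (K.image fun x => (.inl ⟨f x, 0⟩ : Slot Λ C))
    (activeSlots γ K f) (image_subset_iff.2 fun x hx => base_mem_activeSlots hx)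
    (Sum.elim (fun a => a.1) fun _ => Classical.arbitrary C)
    (by
      intro s hs t ht h
      simp only [coe_image, Set.mem_image, mem_coe] at hs ht
      obtain ⟨x, -, rfl⟩ := hs
      obtain ⟨y, -, rfl⟩ := ht
      simp only [Sum.elim_inl] at h
      rw [h])
    (by rw [card_activeSlots hγ]; omega)
  exact ⟨p, hinj, fun x hx => hp _ (Or.inl (mem_image_of_mem _ hx))⟩

omit [DecidableEq V] in
theorem activeSlots_congr {f' : V → C} (h : ∀ x ∈ K, f x = f' x) :
    activeSlots γ K f = activeSlots γ K f' := by
  have : ∀ a, ({x ∈ K | f x = a} : Finset V) = {x ∈ K | f' x = a} := fun a =>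
    filter_congr fun x hx => by rw [h x hx]
  simp only [activeSlots, this]

omit [Fintype Λ] [Fintype C] in
-- Slots see a coloring only through the bag. This lets two branches be treated one after the other,
-- and makes the final form, with an empty bag, independent of the initial coloring.
theorem slot_congr {f' : V → C} {O' : V → Finset V} {w : V} (h : ∀ x ∈ K, f x = f' x)
    (hO : O w = O' w) : slot γ K O f w = slot γ K O' f' w := by
  by_cases hex : ∃ y ∈ K, γ y = γ w
  · rw [slot, slot, dif_pos hex, dif_pos hex, hO, h _ hex.choose_spec.1]
    congr 3
    exact filter_congr fun x hx => by rw [h x hx]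
  · rw [slot, slot, dif_neg hex, dif_neg hex]

omit [DecidableEq V] in
theorem IsPalette.congr {f' : V → C} (h : ∀ x ∈ K, f x = f' x) (hp : IsPalette γ K f p) :
    IsPalette γ K f' p :=
  ⟨activeSlots_congr (γ := γ) h ▸ hp.injOn, fun x hx => by rw [← h x hx]; exact hp.base x hx⟩

end Slots

/-! ### Colorings prescribed by slots are proper -/

section State

variable {V Λ : Type*} [DecidableEq V] [Fintype Λ] [DecidableEq Λ]
variable {G : SimpleGraph V} {k : ℕ}

/-- The forgotten vertices `D` are separated from the rest of the graph by the bag `K`, whose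
vertices have distinct types. -/
structure IsSeparated (G : SimpleGraph V) (γ : V → Λ) (K D : Finset V) : Prop where
  injOn : Set.InjOn γ K
  disjoint : Disjoint K D
  closed : ∀ w ∈ D, ∀ x, G.Adj w x → x ∈ K ∨ x ∈ D

/-- For a forgotten vertex `w` whose type is that of a vertex `y` of the bag `K`, the set `O w`
plays the role of the set of the vertices of `K` that are older than `y`. -/
structure IsAgeing (G : SimpleGraph V) (γ : V → Λ) (K D : Finset V) (O : V → Finset V) : Prop where
  subset : ∀ w ∈ D, ∀ x ∈ O w, x ∈ K ∨ x ∈ D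
  notMem : ∀ w ∈ D, ∀ y ∈ K, γ y = γ w → y ∉ O w
  mem_of_adj : ∀ w ∈ D, ∀ y ∈ K, γ y = γ w → ∀ x ∈ K, G.Adj w x → x ∈ O w
  nested : ∀ w ∈ D, ∀ w' ∈ D, G.Adj w w' → ∀ y ∈ K, ∀ y' ∈ K, γ y = γ w → γ y' = γ w' →
    (y ∈ O w' ∧ ∀ x ∈ K, x ∈ O w → x ∈ O w') ∨ (y' ∈ O w ∧ ∀ x ∈ K, x ∈ O w' → x ∈ O w)

/-- The coloring that agrees with `f` outside of `D` and gives to every vertex of `D` the color of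
its slot. -/
noncomputable def slotColor (γ : V → Λ) (K D : Finset V) (O : V → Finset V) (f : V → Fin k)
    (p : Slot Λ (Fin k) → Fin k) (w : V) : Fin k :=
  if w ∈ D then p (slot γ K O f w) else f w

variable {γ : V → Λ} {K D : Finset V} {O : V → Finset V} {f : V → Fin k}
  {p : Slot Λ (Fin k) → Fin k}

omit [Fintype Λ] in
theorem slotColor_of_mem {w : V} (hw : w ∈ D) :
    slotColor γ K D O f p w = p (slot γ K O f w) := if_pos hw

omit [Fintype Λ] in
theorem slotColor_of_notMem {w : V} (hw : w ∉ D) : slotColor γ K D O f p w = f w := if_neg hw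

theorem IsAgeing.slot_mem (hS : IsSeparated G γ K D) (hO : IsAgeing G γ K D O) {w : V}
    (hw : w ∈ D) : slot γ K O f w ∈ activeSlots γ K f :=
  slot_mem_activeSlots hS.injOn (hO.notMem w hw)

omit [Fintype Λ] in
-- If both types occur in the bag with the same color, `nested` makes one set of older vertices
-- contain the other together with the corresponding bag vertex, so the ranks differ strictly. A
-- rank slot is never a type slot, and two type slots differ because adjacent vertices have distinct
-- types.
theorem IsAgeing.slot_ne_of_adj (hγ : ∀ x y, G.Adj x y → γ x ≠ γ y) (hS : IsSeparated G γ K D)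
    (hO : IsAgeing G γ K D O) {w w' : V} (hw : w ∈ D) (hw' : w' ∈ D) (h : G.Adj w w') :
    slot γ K O f w ≠ slot γ K O f w' := by
  have key : ∀ w ∈ D, ∀ w' ∈ D, ∀ y ∈ K, ∀ y' ∈ K, γ y = γ w → γ y' = γ w' → f y = f y' →
      (y ∈ O w' ∧ ∀ x ∈ K, x ∈ O w → x ∈ O w') →
      #{x ∈ K | x ∈ O w ∧ f x = f y} < #{x ∈ K | x ∈ O w' ∧ f x = f y'} := by
    rintro w hw w' hw' y hy y' hy' hyw hyw' hf ⟨hyO, hsub⟩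
    refine card_lt_card ⟨fun x hx => ?_, fun hle => ?_⟩
    · simp only [mem_filter] at hx ⊢
      exact ⟨hx.1, hsub x hx.1 hx.2.1, hx.2.2.trans hf⟩
    · have := hle (mem_filter.2 ⟨hy, hyO, hf⟩)
      exact hO.notMem w hw y hy hyw (mem_filter.1 this).2.1
  intro heq
  by_cases h1 : ∃ y ∈ K, γ y = γ w <;> by_cases h2 : ∃ y ∈ K, γ y = γ w'
  · obtain ⟨y, hy, hyw⟩ := h1
    obtain ⟨y', hy', hyw'⟩ := h2
    rw [slot_of_mem hS.injOn hy hyw, slot_of_mem hS.injOn hy' hyw'] at heq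
    simp only [Sum.inl.injEq, Sigma.mk.injEq, heq_eq_eq] at heq
    rcases hO.nested w hw w' hw' h y hy y' hy' hyw hyw' with hn | hn
    · exact (key w hw w' hw' y hy y' hy' hyw hyw' heq.1 hn).ne heq.2
    · exact (key w' hw' w hw y' hy' y hy hyw' hyw heq.1.symm hn).ne' heq.2
  · obtain ⟨y, hy, hyw⟩ := h1
    push Not at h2
    rw [slot_of_mem hS.injOn hy hyw, slot_of_forall_ne h2] at heq
    simp at heq
  · obtain ⟨y', hy', hyw'⟩ := h2
    push Not at h1
    rw [slot_of_mem hS.injOn hy' hyw', slot_of_forall_ne h1] at heq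
    simp at heq
  · push Not at h1 h2
    rw [slot_of_forall_ne h1, slot_of_forall_ne h2] at heq
    exact hγ w w' h (Sum.inr_injective heq)

omit [Fintype Λ] in
-- A bag neighbor `x` of `w` counts as older, so if it has the color in the slot of `w`, the rank
-- there is positive.
theorem IsAgeing.slot_ne_base_of_adj (hS : IsSeparated G γ K D)
    (hO : IsAgeing G γ K D O) {w x : V} (hw : w ∈ D) (hx : x ∈ K) (h : G.Adj w x) :
    slot γ K O f w ≠ .inl ⟨f x, 0⟩ := by
  intro heq
  by_cases h1 : ∃ y ∈ K, γ y = γ w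
  · obtain ⟨y, hy, hyw⟩ := h1
    rw [slot_of_mem hS.injOn hy hyw] at heq
    simp only [Sum.inl.injEq, Sigma.mk.injEq, heq_eq_eq, card_eq_zero,
      filter_eq_empty_iff] at heq
    exact heq.2 hx ⟨hO.mem_of_adj w hw y hy hyw x hx h, heq.1.symm⟩
  · push Not at h1
    rw [slot_of_forall_ne h1] at heq
    simp at heq

theorem IsAgeing.slotColor_valid (hγ : ∀ x y, G.Adj x y → γ x ≠ γ y) (hS : IsSeparated G γ K D)
    (hO : IsAgeing G γ K D O) (hf : ∀ x y, G.Adj x y → f x ≠ f y) (hp : IsPalette γ K f p)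
    {x y : V} (h : G.Adj x y) : slotColor γ K D O f p x ≠ slotColor γ K D O f p y := by
  have key : ∀ w ∈ D, ∀ x ∉ D, G.Adj w x →
      slotColor γ K D O f p w ≠ slotColor γ K D O f p x := by
    intro w hw x hx hwx heq
    have hxK : x ∈ K := (hS.closed w hw x hwx).resolve_right hx
    rw [slotColor_of_mem hw, slotColor_of_notMem hx, ← hp.base x hxK] at heq
    exact hO.slot_ne_base_of_adj hS hw hxK hwx
      (hp.injOn (hO.slot_mem hS hw) (base_mem_activeSlots hxK) heq)
  by_cases hx : x ∈ D <;> by_cases hy : y ∈ D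
  · rw [slotColor_of_mem hx, slotColor_of_mem hy]
    exact fun heq => hO.slot_ne_of_adj hγ hS hx hy h
      (hp.injOn (hO.slot_mem hS hx) (hO.slot_mem hS hy) heq)
  · exact key x hx y hy h
  · exact (key y hy x hx h.symm).symm
  · rw [slotColor_of_notMem hx, slotColor_of_notMem hy]
    exact hf x y h

/-- The proper coloring with the underlying map `slotColor`. -/
noncomputable def slotColoring (hγ : ∀ x y, G.Adj x y → γ x ≠ γ y) (hS : IsSeparated G γ K D)
    (hO : IsAgeing G γ K D O) (f : G.Coloring (Fin k)) (hp : IsPalette γ K f p) :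
    G.Coloring (Fin k) :=
  SimpleGraph.Coloring.mk (slotColor γ K D O f p) fun h =>
    hO.slotColor_valid hγ hS (fun _ _ => f.valid) hp h

theorem slotColoring_apply (hγ : ∀ x y, G.Adj x y → γ x ≠ γ y) (hS : IsSeparated G γ K D)
    (hO : IsAgeing G γ K D O) (f : G.Coloring (Fin k)) (hp : IsPalette γ K f p) (x : V) :
    slotColoring hγ hS hO f hp x = slotColor γ K D O f p x := rfl

end State

/-! ### Passing from one palette to another -/

section Palettes

variable {V Λ : Type*} [Fintype V] [DecidableEq V] [Fintype Λ] [DecidableEq Λ]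
variable {G : SimpleGraph V} {k : ℕ} {γ : V → Λ} {K D : Finset V} {O : V → Finset V}

/-- The number of steps in which the color `p s` of a slot is changed to `p' s` when all slots
of `S` pass from the palette `p` to the palette `p'`. -/
def slotCost {Λ : Type*} {C : Type*} [DecidableEq C] (S : Finset (Slot Λ C))
    (p p' : Slot Λ C → C) (s : Slot Λ C) : ℕ :=
  if p s = p' s then 0 else if p s ∈ S.image p' then 2 else 1

omit [Fintype Λ] [DecidableEq Λ] in
theorem slotCost_le_two {C : Type*} [DecidableEq C] (S : Finset (Slot Λ C))
    (p p' : Slot Λ C → C) (s : Slot Λ C) : slotCost S p p' s ≤ 2 := by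
  unfold slotCost; split_ifs <;> omega

/-- Changing the color of one slot to a color that is not in use. -/
theorem edist_slotColoring_update (hγ : ∀ x y, G.Adj x y → γ x ≠ γ y) (hS : IsSeparated G γ K D)
    (hO : IsAgeing G γ K D O) (f : G.Coloring (Fin k)) {p p₁ : Slot Λ (Fin k) → Fin k}
    (hp : IsPalette γ K f p) (hp₁ : IsPalette γ K f p₁) (s : Slot Λ (Fin k))
    (hs : p₁ s ∉ (activeSlots γ K f).image p) (hne : ∀ t, t ≠ s → p₁ t = p t) :
    (recoloringGraph G k).edist (slotColoring hγ hS hO f hp) (slotColoring hγ hS hO f hp₁) ≤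
      (#{w ∈ D | slot γ K O f w = s} : ℕ) := by
  have hchange : ∀ x, slotColor γ K D O f p x ≠ slotColor γ K D O f p₁ x →
      x ∈ D ∧ slot γ K O f x = s := by
    intro x hx
    have hxD : x ∈ D := by
      by_contra hxD
      exact hx (by rw [slotColor_of_notMem hxD, slotColor_of_notMem hxD])
    refine ⟨hxD, ?_⟩
    by_contra hxs
    exact hx (by rw [slotColor_of_mem hxD, slotColor_of_mem hxD, hne _ hxs])
  -- The new color is on no vertex of `D` beforehand, so the order is irrelevant.
  refine (edist_recoloringGraph_le_of_priority (fun _ => 0) _ _ fun x y hxy _ => ?_).trans ?_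
  · simp only [slotColoring_apply]
    by_cases hy : slotColor γ K D O f p y = slotColor γ K D O f p₁ y
    · rw [hy]; exact (slotColoring hγ hS hO f hp₁).valid hxy
    by_cases hx : slotColor γ K D O f p x = slotColor γ K D O f p₁ x
    · rw [← hx]; exact (slotColoring hγ hS hO f hp).valid hxy
    obtain ⟨hyD, -⟩ := hchange y hy
    obtain ⟨hxD, hxs⟩ := hchange x hx
    rw [slotColor_of_mem hxD, slotColor_of_mem hyD, hxs]
    exact fun h => hs (mem_image.2 ⟨_, hO.slot_mem hS hyD, h.symm⟩)
  · refine Nat.cast_le.2 (card_le_card fun x hx => ?_)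
    exact mem_filter.2 (hchange x (mem_filter.1 hx).2)

omit [Fintype V] [DecidableEq V] in
-- Two palettes agree on the base slots of the bag, so a slot on which they differ may be recolored
-- freely.
theorem IsPalette.update {C : Type*} [Fintype C] [DecidableEq C] {f : V → C}
    {p p' : Slot Λ C → C} (hp : IsPalette γ K f p) (hp' : IsPalette γ K f p') {s : Slot Λ C}
    (hs : p s ≠ p' s) {c : C} (hc : c ∉ (activeSlots γ K f).image p) :
    IsPalette γ K f (Function.update p s c) := by
  refine ⟨fun t ht u hu htu => ?_, fun x hx => ?_⟩
  · rcases eq_or_ne t s with rfl | hts <;> rcases eq_or_ne u t with rfl | hut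
    · rfl
    · rw [Function.update_self, Function.update_of_ne hut] at htu
      exact absurd (mem_image.2 ⟨u, hu, htu.symm⟩) hc
    · rfl
    · rcases eq_or_ne u s with rfl | hus
      · rw [Function.update_self, Function.update_of_ne hts] at htu
        exact absurd (mem_image.2 ⟨t, ht, htu⟩) hc
      · rw [Function.update_of_ne hus, Function.update_of_ne hts] at htu
        exact hp.injOn ht hu htu
  · rw [Function.update_of_ne, hp.base x hx]
    rintro rfl
    exact hs ((hp.base x hx).trans (hp'.base x hx).symm)

/-- Slots move like tokens on colors: a slot goes straight to its target when that is free, and a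
cyclic permutation is broken by parking one slot on the spare color. The cost 2 is reserved for
slots standing on a target color, which may have to be parked; the total cost decreases with each
move. -/
theorem edist_slotColoring_le_sum (hγ : ∀ x y, G.Adj x y → γ x ≠ γ y)
    (hS : IsSeparated G γ K D) (hO : IsAgeing G γ K D O) (f : G.Coloring (Fin k))
    (hC : Fintype.card Λ < k) {p p' : Slot Λ (Fin k) → Fin k}
    (hp : IsPalette γ K f p) (hp' : IsPalette γ K f p') :
    (recoloringGraph G k).edist (slotColoring hγ hS hO f hp) (slotColoring hγ hS hO f hp') ≤
      (∑ w ∈ D, slotCost (activeSlots γ K f) p p' (slot γ K O f w) : ℕ) := by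
  induction hn : ∑ s ∈ activeSlots γ K f, slotCost (activeSlots γ K f) p p' s
    using Nat.strong_induction_on generalizing p with
  | _ n ih =>
    set S := activeSlots γ K f with hSdef
    -- it suffices to change the color of one slot to an unused color so that its cost decreases
    have step : ∀ s ∈ S, p s ≠ p' s → ∀ c, c ∉ S.image p →
        slotCost S (Function.update p s c) p' s + 1 ≤ slotCost S p p' s →
        (recoloringGraph G k).edist (slotColoring hγ hS hO f hp) (slotColoring hγ hS hO f hp') ≤
          (∑ w ∈ D, slotCost S p p' (slot γ K O f w) : ℕ) := by
      intro s hs hne c hc hcost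
      have hp₁ := hp.update hp' hne hc
      have hother : ∀ t, t ≠ s → slotCost S (Function.update p s c) p' t = slotCost S p p' t := by
        intro t ht
        simp only [slotCost, Function.update_of_ne ht]
      have hlt : ∑ t ∈ S, slotCost S (Function.update p s c) p' t < n := by
        rw [← hn]
        refine sum_lt_sum (fun t _ => ?_) ⟨s, hs, by omega⟩
        rcases eq_or_ne t s with rfl | ht
        · omega
        · exact (hother t ht).le
      refine (SimpleGraph.edist_triangle (v := slotColoring hγ hS hO f hp₁)).trans ?_
      refine (add_le_add (edist_slotColoring_update hγ hS hO f hp hp₁ s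
        (by rwa [Function.update_self]) fun t ht => Function.update_of_ne ht _ _)
        (ih _ hlt hp₁ rfl)).trans ?_
      rw [← Nat.cast_add, Nat.cast_le, card_filter, ← sum_add_distrib]
      refine sum_le_sum fun w _ => ?_
      split_ifs with hw
      · rw [hw]; omega
      · rw [hother _ hw]; omega
    by_cases hall : ∀ s ∈ S, p s = p' s
    · have : slotColoring hγ hS hO f hp = slotColoring hγ hS hO f hp' := by
        ext x
        simp only [slotColoring_apply]
        by_cases hx : x ∈ D
        · rw [slotColor_of_mem hx, slotColor_of_mem hx, hall _ (hO.slot_mem hS hx)]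
        · rw [slotColor_of_notMem hx, slotColor_of_notMem hx]
      rw [this]
      simp
    · by_cases hfree : ∃ s ∈ S, p s ≠ p' s ∧ p' s ∉ S.image p
      · obtain ⟨s, hs, hne, hc⟩ := hfree
        refine step s hs hne (p' s) hc ?_
        simp only [slotCost, Function.update_self, if_neg hne, if_true]
        split_ifs <;> omega
      · push Not at hall hfree
        obtain ⟨s, hs, hne⟩ := hall
        have hsub : S.image p' ⊆ S.image p := by
          refine image_subset_iff.2 fun t ht => ?_
          by_cases h : p t = p' t
          · rw [← h]; exact mem_image_of_mem _ ht
          · exact hfree t ht h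
        have heq : S.image p' = S.image p := eq_of_subset_of_card_le hsub (by
          rw [card_image_of_injOn hp.injOn, card_image_of_injOn hp'.injOn])
        -- Both palettes now use the same set of colors, which misses `c`; parking `s` on `c` lowers
        -- its cost from 2 to 1.
        obtain ⟨c, hc⟩ := exists_notMem_image_activeSlots (f := f) (p := p) hS.injOn
          (by simpa using hC)
        refine step s hs hne c hc ?_
        rw [slotCost, slotCost, Function.update_self, if_neg hne, heq,
          if_pos (mem_image_of_mem _ hs), if_neg hc]
        split_ifs <;> omega

theorem edist_slotColoring_le (hγ : ∀ x y, G.Adj x y → γ x ≠ γ y)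
    (hS : IsSeparated G γ K D) (hO : IsAgeing G γ K D O) (f : G.Coloring (Fin k))
    (hC : Fintype.card Λ < k) {p p' : Slot Λ (Fin k) → Fin k}
    (hp : IsPalette γ K f p) (hp' : IsPalette γ K f p') :
    (recoloringGraph G k).edist (slotColoring hγ hS hO f hp) (slotColoring hγ hS hO f hp') ≤
      (2 * #D : ℕ) := by
  refine (edist_slotColoring_le_sum hγ hS hO f hC hp hp').trans (Nat.cast_le.2 ?_)
  rw [mul_comm, ← smul_eq_mul]
  exact sum_le_card_nsmul _ _ _ fun _ _ => slotCost_le_two _ _ _ _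

end Palettes

/-! ### Separation and ageing along the decomposition -/

section Steps

variable {V Λ : Type*} [DecidableEq V] [DecidableEq Λ]
variable {G : SimpleGraph V} {γ : V → Λ} {K D : Finset V} {O : V → Finset V}

omit [DecidableEq Λ] in
theorem IsSeparated.forget (hS : IsSeparated G γ K D) {v : V}
    (hv : ∀ x, G.Adj v x → x ∈ K ∨ x ∈ D) : IsSeparated G γ (K.erase v) (insert v D) where
  injOn := hS.injOn.mono (by exact_mod_cast erase_subset v K)
  disjoint := by
    rw [disjoint_insert_right]
    exact ⟨notMem_erase v K, hS.disjoint.mono_left (erase_subset v K)⟩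
  closed := by
    intro w hw x hwx
    have : x ∈ K ∨ x ∈ D := by
      rcases mem_insert.1 hw with rfl | hw
      · exact hv x hwx
      · exact hS.closed w hw x hwx
    simp only [mem_erase, mem_insert]
    tauto

omit [DecidableEq Λ] in
theorem IsSeparated.introduce (hS : IsSeparated G γ K D) {v : V} (hvD : v ∉ D)
    (hv : ∀ y ∈ K, γ y ≠ γ v) : IsSeparated G γ (insert v K) D where
  injOn := by
    rw [coe_insert, Set.injOn_insert (fun h => hv v h rfl)]
    refine ⟨hS.injOn, ?_⟩
    rintro ⟨y, hy, h⟩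
    exact hv y hy h
  disjoint := disjoint_insert_left.2 ⟨hvD, hS.disjoint⟩
  closed := fun w hw x hwx => by
    have := hS.closed w hw x hwx
    simp only [mem_insert]
    tauto

omit [DecidableEq Λ] in
theorem IsSeparated.join {D₁ D₂ : Finset V} (h₁ : IsSeparated G γ K D₁)
    (h₂ : IsSeparated G γ K D₂) : IsSeparated G γ K (D₁ ∪ D₂) where
  injOn := h₁.injOn
  disjoint := disjoint_union_right.2 ⟨h₁.disjoint, h₂.disjoint⟩
  closed := fun w hw x hwx => by
    rw [mem_union]
    rcases mem_union.1 hw with hw | hw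
    · have := h₁.closed w hw x hwx; tauto
    · have := h₂.closed w hw x hwx; tauto

omit [DecidableEq Λ] in
theorem IsAgeing.forget (hS : IsSeparated G γ K D) (hO : IsAgeing G γ K D O) {v : V}
    (hv : v ∈ K) : IsAgeing G γ (K.erase v) (insert v D) (Function.update O v ∅) := by
  have hne : ∀ y ∈ K.erase v, γ y ≠ γ v := fun y hy h =>
    (mem_erase.1 hy).1 (hS.injOn (mem_of_mem_erase hy) hv h)
  have hvD : v ∉ D := fun h => disjoint_left.1 hS.disjoint hv h
  have hmem : ∀ w ∈ insert v D, ∀ y ∈ K.erase v, γ y = γ w →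
      w ∈ D ∧ Function.update O v ∅ w = O w := by
    intro w hw y hy hyw
    have hwv : w ≠ v := by rintro rfl; exact hne y hy hyw
    exact ⟨mem_of_mem_insert_of_ne hw hwv, Function.update_of_ne hwv _ _⟩
  refine ⟨fun w hw x hx => ?_, fun w hw y hy hyw => ?_, fun w hw y hy hyw x hx hwx => ?_,
    fun w hw w' hw' hww' y hy y' hy' hyw hyw' => ?_⟩
  · rcases eq_or_ne w v with rfl | hwv
    · simp at hx
    · rw [Function.update_of_ne hwv] at hx
      have := hO.subset w (mem_of_mem_insert_of_ne hw hwv) x hx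
      simp only [mem_erase, mem_insert]
      tauto
  · obtain ⟨hwD, h⟩ := hmem w hw y hy hyw
    rw [h]
    exact hO.notMem w hwD y (mem_of_mem_erase hy) hyw
  · obtain ⟨hwD, h⟩ := hmem w hw y hy hyw
    rw [h]
    exact hO.mem_of_adj w hwD y (mem_of_mem_erase hy) hyw x (mem_of_mem_erase hx) hwx
  · obtain ⟨hwD, h⟩ := hmem w hw y hy hyw
    obtain ⟨hwD', h'⟩ := hmem w' hw' y' hy' hyw'
    rw [h, h']
    exact (hO.nested w hwD w' hwD' hww' y (mem_of_mem_erase hy) y' (mem_of_mem_erase hy')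
      hyw hyw').imp (fun h => ⟨h.1, fun x hx => h.2 x (mem_of_mem_erase hx)⟩)
      (fun h => ⟨h.1, fun x hx => h.2 x (mem_of_mem_erase hx)⟩)

/-- The ageing function after the introduction of `v`: the vertices of the bag are older than `v`
from the viewpoint of the forgotten vertices of its type. -/
def introduceAgeing (γ : V → Λ) (K : Finset V) (O : V → Finset V) (v w : V) : Finset V :=
  if γ w = γ v then K else O w

/-- The new vertex is the youngest. By `subset` it lies in no earlier set of older vertices, and by
separation it has no forgotten neighbor, so the relations among the other types persist. -/
theorem IsAgeing.introduce (hγ : ∀ x y, G.Adj x y → γ x ≠ γ y) (hS : IsSeparated G γ K D)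
    (hO : IsAgeing G γ K D O) {v : V} (hvD : v ∉ D) (hv : ∀ y ∈ K, γ y ≠ γ v) :
    IsAgeing G γ (insert v K) D (introduceAgeing γ K O v) := by
  have hvK : v ∉ K := fun h => hv v h rfl
  have hvO : ∀ w ∈ D, v ∉ O w := fun w hw h => by
    have := hO.subset w hw v h
    tauto
  have hadj : ∀ w ∈ D, ¬ G.Adj w v := fun w hw h => by
    have := hS.closed w hw v h
    tauto
  have hvA : ∀ w ∈ D, v ∉ introduceAgeing γ K O v w := fun w hw => by
    unfold introduceAgeing
    split_ifs
    exacts [hvK, hvO w hw]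
  have htype : ∀ w, ∀ y ∈ insert v K, γ y = γ w → γ w ≠ γ v → y ∈ K := fun w y hy hyw hwv =>
    mem_of_mem_insert_of_ne hy (by rintro rfl; exact hwv hyw.symm)
  have hold : ∀ w, γ w ≠ γ v → introduceAgeing γ K O v w = O w := fun w hw => if_neg hw
  have hnew : ∀ w, γ w = γ v → introduceAgeing γ K O v w = K := fun w hw => if_pos hw
  refine ⟨fun w hw x hx => ?_, fun w hw y hy hyw => ?_, fun w hw y hy hyw x hx hwx => ?_,
    fun w hw w' hw' hww' y hy y' hy' hyw hyw' => ?_⟩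
  · rw [mem_insert]
    by_cases h : γ w = γ v
    · rw [hnew w h] at hx; tauto
    · rw [hold w h] at hx
      have := hO.subset w hw x hx
      tauto
  · by_cases h : γ w = γ v
    · rw [hnew w h]
      exact fun hyK => hv y hyK (hyw.trans h)
    · rw [hold w h]
      exact hO.notMem w hw y (htype w y hy hyw h) hyw
  · have hxK : x ∈ K := mem_of_mem_insert_of_ne hx (by rintro rfl; exact hadj w hw hwx)
    by_cases h : γ w = γ v
    · rwa [hnew w h]
    · rw [hold w h]
      exact hO.mem_of_adj w hw y (htype w y hy hyw h) hyw x hxK hwx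
  · have hrestrict : ∀ u ∈ D, ∀ A : Finset V, (∀ x ∈ K, x ∈ introduceAgeing γ K O v u → x ∈ A) →
        ∀ x ∈ insert v K, x ∈ introduceAgeing γ K O v u → x ∈ A := fun u hu A h x hx hxu =>
      h x (mem_of_mem_insert_of_ne hx (by rintro rfl; exact hvA u hu hxu)) hxu
    by_cases h : γ w = γ v
    · have h' : γ w' ≠ γ v := fun h' => hγ w w' hww' (h.trans h'.symm)
      refine Or.inr ⟨?_, hrestrict w' hw' _ fun x hx _ => ?_⟩ <;> rw [hnew w h]
      exacts [htype w' y' hy' hyw' h', hx]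
    · by_cases h' : γ w' = γ v
      · refine Or.inl ⟨?_, hrestrict w hw _ fun x hx _ => ?_⟩ <;> rw [hnew w' h']
        exacts [htype w y hy hyw h, hx]
      · refine (hO.nested w hw w' hw' hww' y (htype w y hy hyw h) y' (htype w' y' hy' hyw' h')
          hyw hyw').imp (fun hn => ⟨?_, hrestrict w hw _ ?_⟩)
          (fun hn => ⟨?_, hrestrict w' hw' _ ?_⟩) <;> simp only [hold w h, hold w' h']
        exacts [hn.1, hn.2, hn.1, hn.2]

omit [DecidableEq V] [DecidableEq Λ] in
theorem IsAgeing.congr {O' : V → Finset V} (hO : IsAgeing G γ K D O) (h : ∀ w ∈ D, O w = O' w) :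
    IsAgeing G γ K D O' where
  subset w hw := h w hw ▸ hO.subset w hw
  notMem w hw := h w hw ▸ hO.notMem w hw
  mem_of_adj w hw := h w hw ▸ hO.mem_of_adj w hw
  nested w hw w' hw' := h w hw ▸ h w' hw' ▸ hO.nested w hw w' hw'

omit [DecidableEq Λ] in
-- The two parts may order the bag differently: `nested` compares only adjacent vertices, and no
-- edge joins `D₁` to `D₂`.
theorem IsAgeing.join {D₁ D₂ : Finset V} (hD : Disjoint D₁ D₂) (hS₁ : IsSeparated G γ K D₁)
    (hS₂ : IsSeparated G γ K D₂) (h₁ : IsAgeing G γ K D₁ O) (h₂ : IsAgeing G γ K D₂ O) :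
    IsAgeing G γ K (D₁ ∪ D₂) O where
  subset w hw x hx := by
    rw [mem_union]
    rcases mem_union.1 hw with hw | hw
    · have := h₁.subset w hw x hx; tauto
    · have := h₂.subset w hw x hx; tauto
  notMem w hw := (mem_union.1 hw).elim (h₁.notMem w) (h₂.notMem w)
  mem_of_adj w hw := (mem_union.1 hw).elim (h₁.mem_of_adj w) (h₂.mem_of_adj w)
  nested w hw w' hw' hww' := by
    have hno : ∀ a ∈ D₁, ∀ b ∈ D₂, ¬ G.Adj a b := fun a ha b hb hab =>
      (hS₁.closed a ha b hab).elim (fun h => disjoint_left.1 hS₂.disjoint h hb)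
        (fun h => disjoint_left.1 hD h hb)
    rcases mem_union.1 hw with hw | hw <;> rcases mem_union.1 hw' with hw' | hw'
    · exact h₁.nested w hw w' hw' hww'
    · exact absurd hww' (hno w hw w' hw')
    · exact absurd hww'.symm (hno w' hw' w hw)
    · exact h₂.nested w hw w' hw' hww'

end Steps

/-! ### The cost of forgetting and of introducing a vertex -/

section Moves

variable {V Λ : Type*} [Fintype V] [DecidableEq V] [Fintype Λ] [DecidableEq Λ]
variable {G : SimpleGraph V} {k : ℕ} {γ : V → Λ} {K D : Finset V} {O : V → Finset V}

omit [Fintype V] in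
theorem activeSlots_erase {C : Type*} [Fintype C] [DecidableEq C] {f : V → C} {v : V}
    {s : Slot Λ C} (hs : s ∈ activeSlots γ (K.erase v) f) (hne : s ≠ .inr (γ v)) :
    s ∈ activeSlots γ K f := by
  rcases s with ⟨a, i⟩ | j
  · rw [inl_mem_activeSlots] at hs ⊢
    exact hs.trans_le (card_le_card (filter_subset_filter _ (erase_subset v K)))
  · rw [inr_mem_activeSlots] at hs ⊢
    intro y hy hyj
    rcases eq_or_ne y v with rfl | hyv
    · exact hne (by rw [hyj])
    · exact hs y (mem_erase.2 ⟨hyv, hy⟩) hyj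

omit [Fintype V] [Fintype Λ] in
/-- After the removal of `v` from the bag, a slot either is unchanged or loses one rank. -/
theorem slot_erase {C : Type*} [Fintype C] [DecidableEq C] {f : V → C} (hγ : Set.InjOn γ K)
    {v w : V} (hv : v ∈ K) (hw : γ w ≠ γ v) :
    slot γ (K.erase v) O f w = slot γ K O f w ∨
      ∃ a i, slot γ K O f w = .inl ⟨a, i + 1⟩ ∧ slot γ (K.erase v) O f w = .inl ⟨a, i⟩ := by
  have hγ' : Set.InjOn γ (K.erase v) := hγ.mono (by exact_mod_cast erase_subset v K)
  by_cases h : ∃ y ∈ K, γ y = γ w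
  · obtain ⟨y, hy, hyw⟩ := h
    have hy' : y ∈ K.erase v := mem_erase.2 ⟨by rintro rfl; exact hw hyw.symm, hy⟩
    rw [slot_of_mem hγ hy hyw, slot_of_mem hγ' hy' hyw, filter_erase]
    by_cases hmem : v ∈ ({x ∈ K | x ∈ O w ∧ f x = f y} : Finset V)
    · refine Or.inr ⟨_, _, ?_, rfl⟩
      rw [card_erase_add_one hmem]
    · exact Or.inl (by rw [erase_eq_of_notMem hmem])
  · push Not at h
    exact Or.inl (by
      rw [slot_of_forall_ne h, slot_of_forall_ne fun y hy => h y (mem_of_mem_erase hy)])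

/-- The vertices of the type of `v`, including `v`, move to a spare color, which becomes the color
of that type. Vertices that ranked `v` as an older vertex of their color then move down one rank.
Each vertex changes at most once. -/
theorem exists_edist_forget_le (hγ : ∀ x y, G.Adj x y → γ x ≠ γ y) (hC : Fintype.card Λ < k)
    (hS : IsSeparated G γ K D) (hO : IsAgeing G γ K D O) {v : V} (hv : v ∈ K)
    (hS' : IsSeparated G γ (K.erase v) (insert v D))
    (hO' : IsAgeing G γ (K.erase v) (insert v D) (Function.update O v ∅))
    (f : G.Coloring (Fin k)) {p : Slot Λ (Fin k) → Fin k} (hp : IsPalette γ K f p) :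
    ∃ p', ∃ hp' : IsPalette γ (K.erase v) f p',
      (recoloringGraph G k).edist (slotColoring hγ hS hO f hp)
        (slotColoring hγ hS' hO' f hp') ≤ (#D + 1 : ℕ) := by
  have hvD : v ∉ D := fun h => disjoint_left.1 hS.disjoint hv h
  obtain ⟨c, hc⟩ := exists_notMem_image_activeSlots (f := f) (p := p) hS.injOn (by simpa using hC)
  have hc' : ∀ s ∈ activeSlots γ K f, p s ≠ c := fun s hs h => hc (mem_image.2 ⟨s, hs, h⟩)
  set p' := Function.update p (.inr (γ v)) c with hp'def
  have hp'c : p' (.inr (γ v)) = c := Function.update_self ..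
  have hp'ne : ∀ s, s ≠ .inr (γ v) → p' s = p s := fun s hs => Function.update_of_ne hs ..
  have hpal : IsPalette γ (K.erase v) f p' := by
    refine ⟨fun s hs t ht hst => ?_, fun x hx => ?_⟩
    · by_cases hs' : s = .inr (γ v) <;> by_cases ht' : t = .inr (γ v)
      · rw [hs', ht']
      · rw [hs', hp'c, hp'ne t ht'] at hst
        exact absurd hst.symm (hc' t (activeSlots_erase ht ht'))
      · rw [ht', hp'c, hp'ne s hs'] at hst
        exact absurd hst (hc' s (activeSlots_erase hs hs'))
      · rw [hp'ne s hs', hp'ne t ht'] at hst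
        exact hp.injOn (activeSlots_erase hs hs') (activeSlots_erase ht ht') hst
    · rw [hp'ne _ (by simp)]
      exact hp.base x (mem_of_mem_erase hx)
  refine ⟨p', hpal, ?_⟩
  -- First the type of `v`, bound for the fresh color, then increasing ranks: rank `i` must be
  -- vacated before rank `i + 1` moves into it.
  let ρ : V → ℕ := fun w => if γ w = γ v then 0 else
    Sum.elim (fun a => a.2) (fun _ => 0) (slot γ K O f w)
  set g := slotColoring hγ hS hO f hp with hg
  set g' := slotColoring hγ hS' hO' f hpal with hg'
  have hout : ∀ w, w ∉ insert v D → g w = g' w := fun w hw => by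
    rw [hg, hg', slotColoring_apply, slotColoring_apply, slotColor_of_notMem hw,
      slotColor_of_notMem fun h => hw (mem_insert_of_mem h)]
  -- the vertices that change their color
  have hchange : ∀ w, g w ≠ g' w → (γ w = γ v ∧ g' w = c) ∨ (γ w ≠ γ v ∧ w ∈ D ∧
      ∃ a i, slot γ K O f w = .inl ⟨a, i + 1⟩ ∧ g w = p (.inl ⟨a, i + 1⟩) ∧
        g' w = p (.inl ⟨a, i⟩)) := by
    intro w hw
    have hwD' : w ∈ insert v D := by
      by_contra h
      exact hw (hout w h)
    have hg'w : g' w = p' (slot γ (K.erase v) (Function.update O v ∅) f w) := by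
      rw [hg', slotColoring_apply, slotColor_of_mem hwD']
    by_cases hwv : γ w = γ v
    · refine Or.inl ⟨hwv, ?_⟩
      rw [hg'w, slot_of_forall_ne, hwv, hp'c]
      intro y hy h
      exact (mem_erase.1 hy).1 (hS.injOn (mem_of_mem_erase hy) hv (h.trans hwv))
    · have hne : w ≠ v := by rintro rfl; exact hwv rfl
      have hwD : w ∈ D := mem_of_mem_insert_of_ne hwD' hne
      rw [slot_congr (O' := O) (fun _ _ => rfl) (Function.update_of_ne hne _ _)] at hg'w
      have hgw : g w = p (slot γ K O f w) := by
        rw [hg, slotColoring_apply, slotColor_of_mem hwD]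
      rcases slot_erase (O := O) (f := f) hS.injOn hv hwv with heq | ⟨a, i, h1, h2⟩
      · have hmem := hO.slot_mem (f := f) hS hwD
        have : slot γ K O f w ≠ .inr (γ v) := by
          intro h
          rw [h, inr_mem_activeSlots] at hmem
          exact hmem v hv rfl
        exact absurd (by rw [hgw, hg'w, heq, hp'ne _ this]) hw
      · refine Or.inr ⟨hwv, hwD, a, i, h1, by rw [hgw, h1], ?_⟩
        rw [hg'w, h2, hp'ne _ (by simp)]
  have hgc : ∀ w, g w ≠ g' w → g w ≠ c := by
    intro w hw
    have hwD' : w ∈ insert v D := by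
      by_contra h
      exact hw (hout w h)
    rcases mem_insert.1 hwD' with rfl | hwD
    · rw [hg, slotColoring_apply, slotColor_of_notMem hvD, ← hp.base w hv]
      exact hc' _ (base_mem_activeSlots hv)
    · rw [hg, slotColoring_apply, slotColor_of_mem hwD]
      exact hc' _ (hO.slot_mem hS hwD)
  refine (edist_recoloringGraph_le_of_priority ρ g g' fun x y hxy hρ => ?_).trans ?_
  · by_cases hy : g y = g' y
    · rw [hy]; exact g'.valid hxy
    by_cases hx : g x = g' x
    · rw [← hx]; exact g.valid hxy
    rcases hchange x hx with ⟨-, hxc⟩ | ⟨hxv, hxD, a, i, hxs, -, hx'⟩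
    · rw [hxc]; exact (hgc y hy).symm
    · have hρx : ρ x = i + 1 := by simp [ρ, hxv, hxs]
      rcases hchange y hy with ⟨hyv, -⟩ | ⟨hyv, hyD, b, j, hys, hy', -⟩
      · have : ρ y = 0 := by simp [ρ, hyv]
        omega
      · have hρy : ρ y = j + 1 := by simp [ρ, hyv, hys]
        have hxm := hO.slot_mem (f := f) hS hxD
        have hym := hO.slot_mem (f := f) hS hyD
        rw [hxs, inl_mem_activeSlots] at hxm
        rw [hys] at hym
        rw [hx', hy']
        intro h
        have := hp.injOn (inl_mem_activeSlots.2 (by omega)) hym h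
        simp only [Sum.inl.injEq, Sigma.mk.injEq, heq_eq_eq] at this
        omega
  · rw [← card_insert_of_notMem hvD]
    refine Nat.cast_le.2 (card_le_card fun w hw => ?_)
    by_contra h
    exact (mem_filter.1 hw).2 (hout w h)

omit [Fintype V] in
theorem activeSlots_insert {C : Type*} [Fintype C] [DecidableEq C] {f : V → C} {v : V}
    (hv : v ∉ K) {s : Slot Λ C} (hs : s ∈ activeSlots γ (insert v K) f) :
    s = .inl ⟨f v, #{x ∈ K | f x = f v}⟩ ∨ s ∈ activeSlots γ K f ∧ s ≠ .inr (γ v) := by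
  rcases s with ⟨a, i⟩ | j
  · rw [inl_mem_activeSlots, filter_insert] at hs
    split_ifs at hs with h
    · subst h
      rw [card_insert_of_notMem (by simp [hv])] at hs
      rcases (Nat.lt_succ_iff.1 hs).eq_or_lt with rfl | hlt
      · exact Or.inl rfl
      · exact Or.inr ⟨inl_mem_activeSlots.2 hlt, by simp⟩
    · exact Or.inr ⟨inl_mem_activeSlots.2 hs, by simp⟩
  · rw [inr_mem_activeSlots] at hs
    refine Or.inr ⟨inr_mem_activeSlots.2 fun y hy => hs y (mem_insert_of_mem hy), ?_⟩
    intro h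
    exact hs v (mem_insert_self v K) (Sum.inr_injective h).symm

omit [Fintype V] [Fintype Λ] in
theorem slot_introduce_of_eq {C : Type*} [Fintype C] [DecidableEq C] {f : V → C} {v w : V}
    (hγ : Set.InjOn γ (insert v K : Finset V)) (hv : v ∉ K) (hw : γ w = γ v) :
    slot γ (insert v K) (introduceAgeing γ K O v) f w =
      .inl ⟨f v, #{x ∈ K | f x = f v}⟩ := by
  rw [slot_of_mem hγ (mem_insert_self v K) hw.symm, introduceAgeing, if_pos hw, filter_insert,
    if_neg fun h => hv h.1]
  congr 3
  exact filter_congr fun x hx => and_iff_right hx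

omit [Fintype V] [Fintype Λ] in
theorem slot_introduce_of_ne {C : Type*} [Fintype C] [DecidableEq C] {f : V → C} {v w : V}
    (hγ : Set.InjOn γ (insert v K : Finset V)) (hvO : v ∉ O w) (hw : γ w ≠ γ v) :
    slot γ (insert v K) (introduceAgeing γ K O v) f w = slot γ K O f w := by
  have hγ' : Set.InjOn γ K := hγ.mono (by exact_mod_cast subset_insert v K)
  by_cases h : ∃ y ∈ K, γ y = γ w
  · obtain ⟨y, hy, hyw⟩ := h
    rw [slot_of_mem hγ (mem_insert_of_mem hy) hyw, slot_of_mem hγ' hy hyw, introduceAgeing,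
      if_neg hw, filter_insert, if_neg fun h => hvO h.1]
  · push Not at h
    rw [slot_of_forall_ne h, slot_of_forall_ne]
    intro y hy
    rcases mem_insert.1 hy with rfl | hy
    exacts [hw.symm, h y hy]

/-- The type slot of `v` is replaced by the last rank of the color of `v`. Recoloring is needed only
when this color is new to the bag and therefore must become the color of a base slot. -/
theorem exists_edist_introduce_le (hγ : ∀ x y, G.Adj x y → γ x ≠ γ y)
    (hC : Fintype.card Λ < k) (hS : IsSeparated G γ K D) (hO : IsAgeing G γ K D O) {v : V}
    (hvD : v ∉ D) (hv : ∀ y ∈ K, γ y ≠ γ v) (hS' : IsSeparated G γ (insert v K) D)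
    (hO' : IsAgeing G γ (insert v K) D (introduceAgeing γ K O v))
    (f : G.Coloring (Fin k)) {p : Slot Λ (Fin k) → Fin k} (hp : IsPalette γ K f p) :
    ∃ p', ∃ hp' : IsPalette γ (insert v K) f p',
      (recoloringGraph G k).edist (slotColoring hγ hS hO f hp)
        (slotColoring hγ hS' hO' f hp') ≤ (#D : ℕ) := by
  have hvK : v ∉ K := fun h => hv v h rfl
  have hvO : ∀ w ∈ D, v ∉ O w := fun w hw h => by
    have := hO.subset w hw v h
    tauto
  have hinr : (.inr (γ v) : Slot Λ (Fin k)) ∈ activeSlots γ K f := inr_mem_activeSlots.2 hv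
  have hslot : ∀ w ∈ D, γ w = γ v → slot γ K O f w = .inr (γ v) := fun w _ hw => by
    rw [← hw, slot_of_forall_ne]
    rwa [hw]
  have hslot_ne : ∀ w ∈ D, γ w ≠ γ v → slot γ K O f w ≠ .inr (γ v) := fun w _ hw h => by
    by_cases hex : ∃ y ∈ K, γ y = γ w
    · obtain ⟨y, hy, hyw⟩ := hex
      rw [slot_of_mem hS.injOn hy hyw] at h
      simp at h
    · push Not at hex
      rw [slot_of_forall_ne hex] at h
      exact hw (Sum.inr_injective h)
  set s₀ : Slot Λ (Fin k) := .inl ⟨f v, #{x ∈ K | f x = f v}⟩ with hs₀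
  have hs₀mem : s₀ ∉ activeSlots γ K f := by simp [hs₀, inl_mem_activeSlots]
  by_cases hm : ∃ x ∈ K, f x = f v
  -- Here `s₀` has positive rank, so it may inherit the color of the type slot that it replaces, and
  -- no vertex changes.
  · set p' := Function.update p s₀ (p (.inr (γ v))) with hp'def
    have hp's₀ : p' s₀ = p (.inr (γ v)) := Function.update_self ..
    have hp'ne : ∀ s, s ≠ s₀ → p' s = p s := fun s hs => Function.update_of_ne hs ..
    have hbase : ∀ x ∈ insert v K, ∃ y ∈ K, f x = f y := fun x hx => by
      rcases mem_insert.1 hx with rfl | hx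
      · obtain ⟨y, hy, h⟩ := hm
        exact ⟨y, hy, h.symm⟩
      · exact ⟨x, hx, rfl⟩
    have hpal : IsPalette γ (insert v K) f p' := by
      refine ⟨fun s hs t ht hst => ?_, fun x hx => ?_⟩
      · rcases activeSlots_insert hvK hs with rfl | ⟨hs, hs'⟩ <;>
          rcases activeSlots_insert hvK ht with rfl | ⟨ht, ht'⟩
        · rfl
        · rw [hp's₀, hp'ne t (fun h => hs₀mem (h ▸ ht))] at hst
          exact absurd (hp.injOn hinr ht hst).symm ht'
        · rw [hp's₀, hp'ne s (fun h => hs₀mem (h ▸ hs))] at hst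
          exact absurd (hp.injOn hs hinr hst) hs'
        · rw [hp'ne s (fun h => hs₀mem (h ▸ hs)), hp'ne t (fun h => hs₀mem (h ▸ ht))] at hst
          exact hp.injOn hs ht hst
      · obtain ⟨y, hy, h⟩ := hbase x hx
        have hne : (.inl ⟨f y, 0⟩ : Slot Λ (Fin k)) ≠ s₀ := fun h =>
          hs₀mem (h ▸ base_mem_activeSlots hy)
        rw [h, hp'ne _ hne]
        exact hp.base y hy
    refine ⟨p', hpal, ?_⟩
    have : slotColoring hγ hS hO f hp = slotColoring hγ hS' hO' f hpal := by
      ext w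
      rw [slotColoring_apply, slotColoring_apply]
      by_cases hw : w ∈ D
      · rw [slotColor_of_mem hw, slotColor_of_mem hw]
        by_cases hwv : γ w = γ v
        · rw [slot_introduce_of_eq hS'.injOn hvK hwv, hslot w hw hwv, ← hs₀, hp's₀]
        · rw [slot_introduce_of_ne hS'.injOn (hvO w hw) hwv, hp'ne]
          exact fun h => hs₀mem (h ▸ hO.slot_mem hS hw)
      · rw [slotColor_of_notMem hw, slotColor_of_notMem hw]
    rw [this]
    simp
  · push Not at hm
    have hs₀' : s₀ = .inl ⟨f v, 0⟩ := by
      rw [hs₀, card_eq_zero.2 (filter_eq_empty_iff.2 fun x hx => hm x hx)]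
    obtain ⟨c, hc⟩ := exists_notMem_image_activeSlots (f := f) (p := p) hS.injOn
      (by simpa using hC)
    have hc' : ∀ s ∈ activeSlots γ K f, p s ≠ c := fun s hs h => hc (mem_image.2 ⟨s, hs, h⟩)
    -- Now `s₀` is a base slot and must get the color `f v`; an active slot that held this color is
    -- evicted to the unused color `c`.
    set p' : Slot Λ (Fin k) → Fin k :=
      fun s => if s = s₀ then f v else if p s = f v then c else p s with hp'def
    have hp's₀ : p' s₀ = f v := if_pos rfl
    have hp'ne : ∀ s ∈ activeSlots γ K f, p' s = if p s = f v then c else p s :=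
      fun s hs => if_neg fun h : s = s₀ => hs₀mem (h ▸ hs)
    have hp'v : ∀ s ∈ activeSlots γ K f, p' s ≠ f v := fun s hs h => by
      rw [hp'ne s hs] at h
      split_ifs at h with h'
      · exact hc' s hs (h'.trans h.symm)
      · exact h' h
    have hpal : IsPalette γ (insert v K) f p' := by
      refine ⟨fun s hs t ht hst => ?_, fun x hx => ?_⟩
      · rcases activeSlots_insert hvK hs with rfl | ⟨hs, hs'⟩ <;>
          rcases activeSlots_insert hvK ht with rfl | ⟨ht, ht'⟩
        · rfl
        · exact absurd (hst.symm.trans hp's₀) (hp'v t ht)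
        · exact absurd (hst.trans hp's₀) (hp'v s hs)
        · rw [hp'ne s hs, hp'ne t ht] at hst
          split_ifs at hst with h1 h2 h2
          · exact hp.injOn hs ht (h1.trans h2.symm)
          · exact absurd hst.symm (hc' t ht)
          · exact absurd hst (hc' s hs)
          · exact hp.injOn hs ht hst
      · rcases mem_insert.1 hx with rfl | hx
        · rw [← hs₀', hp's₀]
        · rw [hp'ne _ (base_mem_activeSlots hx), hp.base x hx, if_neg (hm x hx)]
    refine ⟨p', hpal, ?_⟩
    -- The color `f v` is vacated before the vertices of the type of `v` take it.
    let ρ : V → ℕ := fun w => if γ w = γ v then 1 else 0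
    set g := slotColoring hγ hS hO f hp with hg
    set g' := slotColoring hγ hS' hO' f hpal with hg'
    have hout : ∀ w, w ∉ D → g w = g' w := fun w hw => by
      rw [hg, hg', slotColoring_apply, slotColoring_apply, slotColor_of_notMem hw,
        slotColor_of_notMem hw]
    have hin : ∀ w, g w ≠ g' w → w ∈ D := fun w hw => by
      by_contra h
      exact hw (hout w h)
    refine (edist_recoloringGraph_le_of_priority ρ g g' fun x y hxy hρ => ?_).trans ?_
    · by_cases hy : g y = g' y
      · rw [hy]; exact g'.valid hxy
      by_cases hx : g x = g' x
      · rw [← hx]; exact g.valid hxy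
      have hxD := hin x hx
      have hyD := hin y hy
      have hxv : γ x ≠ γ v := fun h => by
        have hyv : γ y ≠ γ v := fun h' => hγ x y hxy (h.trans h'.symm)
        have h1 : ρ x = 1 := if_pos h
        have h2 : ρ y = 0 := if_neg hyv
        omega
      have hgx : g x = p (slot γ K O f x) := by
        rw [hg, slotColoring_apply, slotColor_of_mem hxD]
      have hg'x : g' x = p' (slot γ K O f x) := by
        rw [hg', slotColoring_apply, slotColor_of_mem hxD,
          slot_introduce_of_ne hS'.injOn (hvO x hxD) hxv]
      rw [hp'ne _ (hO.slot_mem hS hxD)] at hg'x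
      split_ifs at hg'x with h
      · rw [hg'x, hg, slotColoring_apply, slotColor_of_mem hyD]
        exact (hc' _ (hO.slot_mem hS hyD)).symm
      · exact absurd (hgx.trans hg'x.symm) hx
    · exact Nat.cast_le.2 (card_le_card fun w hw => hin w (mem_filter.1 hw).2)

end Moves

/-! ### Regions and the quadratic bound -/

section Regions

variable {V Λ : Type*} [DecidableEq V]

/-- `Region G γ K D` holds if the vertices of `D` can be separated from the rest of `G` by the bag
`K` through a sequence of introductions and forgettings of vertices and unions of separate
regions with the same bag, such that the vertices of every bag have distinct types. -/
inductive Region (G : SimpleGraph V) (γ : V → Λ) : Finset V → Finset V → Prop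
  | leaf {K : Finset V} : Set.InjOn γ K → Region G γ K ∅
  | introduce {K D : Finset V} {v : V} : Region G γ K D → v ∉ D → (∀ y ∈ K, γ y ≠ γ v) →
      Region G γ (insert v K) D
  | forget {K D : Finset V} {v : V} : Region G γ K D → v ∈ K →
      (∀ x, G.Adj v x → x ∈ K ∨ x ∈ D) → Region G γ (K.erase v) (insert v D)
  | join {K D₁ D₂ : Finset V} : Region G γ K D₁ → Region G γ K D₂ → Disjoint D₁ D₂ →
      Region G γ K (D₁ ∪ D₂)

variable {G : SimpleGraph V} {γ : V → Λ} {K D : Finset V}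

/-- The ageing `O` is chosen before the coloring `f`, so that different colorings reach forms that
are comparable slot by slot; only the palette depends on `f`. -/
theorem Region.exists_edist_le [Fintype V] [Fintype Λ] [DecidableEq Λ] {k : ℕ}
    (hγ : ∀ x y, G.Adj x y → γ x ≠ γ y) (hC : Fintype.card Λ < k) (h : Region G γ K D) :
    ∃ O, ∃ hS : IsSeparated G γ K D, ∃ hO : IsAgeing G γ K D O, ∀ f : G.Coloring (Fin k),
      ∃ p, ∃ hp : IsPalette γ K f p,
        (recoloringGraph G k).edist f (slotColoring hγ hS hO f hp) ≤
          (#D * (#D + #K) : ℕ) := by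
  induction h with
  | leaf hK =>
    refine ⟨fun _ => ∅, ⟨hK, disjoint_empty_right _, by simp⟩,
      ⟨by simp, by simp, by simp, by simp⟩, fun f => ?_⟩
    obtain ⟨p, hp⟩ := exists_isPalette (f := f) hK (by simpa using hC)
    refine ⟨p, hp, ?_⟩
    rw [show slotColoring hγ _ _ f hp = f from by
      ext x; rw [slotColoring_apply, slotColor_of_notMem (notMem_empty x)]]
    simp
  | @introduce K D v _ hvD hv ih =>
    obtain ⟨O, hS, hO, ih⟩ := ih
    refine ⟨_, hS.introduce hvD hv, hO.introduce hγ hS hvD hv, fun f => ?_⟩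
    obtain ⟨p, hp, hpath⟩ := ih f
    obtain ⟨p', hp', hstep⟩ := exists_edist_introduce_le hγ hC hS hO hvD hv
      (hS.introduce hvD hv) (hO.introduce hγ hS hvD hv) f hp
    refine ⟨p', hp', SimpleGraph.edist_triangle.trans ((add_le_add hpath hstep).trans ?_)⟩
    rw [← Nat.cast_add, Nat.cast_le, card_insert_of_notMem fun h => hv v h rfl]
    exact le_of_eq (by ring)
  | @forget K D v _ hv hclosed ih =>
    obtain ⟨O, hS, hO, ih⟩ := ih
    refine ⟨_, hS.forget hclosed, hO.forget hS hv, fun f => ?_⟩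
    obtain ⟨p, hp, hpath⟩ := ih f
    obtain ⟨p', hp', hstep⟩ := exists_edist_forget_le hγ hC hS hO hv
      (hS.forget hclosed) (hO.forget hS hv) f hp
    refine ⟨p', hp', SimpleGraph.edist_triangle.trans ((add_le_add hpath hstep).trans ?_)⟩
    rw [← Nat.cast_add, Nat.cast_le, card_insert_of_notMem fun h => disjoint_left.1 hS.disjoint hv h,
      ← card_erase_add_one hv]
    -- The bound grows by |D| + |K|, with `K` still containing `v`, which covers the |D| + 1 steps
    -- of the move.
    nlinarith
  | @join K D₁ D₂ _ _ hD ih₁ ih₂ =>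
    obtain ⟨O₁, hS₁, hO₁, ih₁⟩ := ih₁
    obtain ⟨O₂, hS₂, hO₂, ih₂⟩ := ih₂
    rcases D₁.eq_empty_or_nonempty with rfl | hne
    · rw [empty_union]
      exact ⟨O₂, hS₂, hO₂, ih₂⟩
    let O : V → Finset V := fun w => if w ∈ D₁ then O₁ w else O₂ w
    have hO₁' : ∀ w ∈ D₁, O₁ w = O w := fun w hw => (if_pos hw).symm
    have hO₂' : ∀ w ∈ D₂, O₂ w = O w := fun w hw =>
      (if_neg fun h => disjoint_left.1 hD h hw).symm
    have hS := hS₁.join hS₂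
    have hO : IsAgeing G γ K (D₁ ∪ D₂) O :=
      IsAgeing.join hD hS₁ hS₂ (hO₁.congr hO₁') (hO₂.congr hO₂')
    refine ⟨O, hS, hO, fun f => ?_⟩
    obtain ⟨p₁, hp₁, hpath₁⟩ := ih₁ f
    set g₁ := slotColoring hγ hS₁ hO₁ f hp₁ with hg₁
    -- The second part starts from `g₁`, which agrees with `f` on the bag; so `p₁` is a palette for
    -- `g₁` as well, and `D₂` can pass from `p₂` to it.
    obtain ⟨p₂, hp₂, hpath₂⟩ := ih₂ g₁
    have hK : ∀ x ∈ K, f x = g₁ x := fun x hx => by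
      rw [hg₁, slotColoring_apply, slotColor_of_notMem fun h => disjoint_left.1 hS₁.disjoint hx h]
    have hp₁' : IsPalette γ K g₁ p₁ := hp₁.congr hK
    have hpath₃ := edist_slotColoring_le hγ hS₂ hO₂ g₁ hC hp₂ hp₁'
    have heq : slotColoring hγ hS₂ hO₂ g₁ hp₁' = slotColoring hγ hS hO f hp₁ := by
      ext x
      rw [slotColoring_apply, slotColoring_apply]
      by_cases hx₂ : x ∈ D₂
      · rw [slotColor_of_mem hx₂, slotColor_of_mem (mem_union_right _ hx₂),
          slot_congr hK (hO₂' x hx₂).symm]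
      · rw [slotColor_of_notMem hx₂, hg₁, slotColoring_apply]
        by_cases hx₁ : x ∈ D₁
        · rw [slotColor_of_mem hx₁, slotColor_of_mem (mem_union_left _ hx₁),
            slot_congr (fun _ _ => rfl) (hO₁' x hx₁)]
        · rw [slotColor_of_notMem hx₁, slotColor_of_notMem (by simp [hx₁, hx₂])]
    rw [heq] at hpath₃
    refine ⟨p₁, hp₁, (SimpleGraph.edist_triangle.trans (add_le_add hpath₁
      (SimpleGraph.edist_triangle.trans (add_le_add hpath₂ hpath₃)))).trans ?_⟩
    rw [← Nat.cast_add, ← Nat.cast_add, Nat.cast_le, card_union_of_disjoint hD]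
    -- The extra 2|D₂| steps are paid for by the cross terms 2|D₁||D₂|; this is why an empty `D₁`
    -- was set aside.
    have : 1 ≤ #D₁ := card_pos.2 hne
    nlinarith

theorem Region.isSeparated (h : Region G γ K D) : IsSeparated G γ K D := by
  induction h with
  | leaf hK => exact ⟨hK, disjoint_empty_right _, by simp⟩
  | introduce _ hvD hv ih => exact ih.introduce hvD hv
  | forget _ _ hclosed ih => exact ih.forget hclosed
  | join _ _ _ ih₁ ih₂ => exact ih₁.join ih₂

theorem Region.forget_of_subset (h : Region G γ K D) {F : Finset V} (hF : F ⊆ K)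
    (hclosed : ∀ v ∈ F, ∀ x, G.Adj v x → x ∈ K ∨ x ∈ D) : Region G γ (K \ F) (F ∪ D) := by
  induction F using Finset.induction_on with
  | empty => simpa using h
  | insert v F hvF ih =>
    have hreg := ih ((subset_insert v F).trans hF) fun w hw => hclosed w (mem_insert_of_mem hw)
    have := hreg.forget (v := v) (mem_sdiff.2 ⟨hF (mem_insert_self v F), hvF⟩) fun x hx => by
      have := hclosed v (mem_insert_self v F) x hx
      simp only [mem_sdiff, mem_union]
      tauto
    rwa [← sdiff_insert, ← insert_union] at this

theorem Region.introduce_of_injOn (h : Region G γ K D) {F : Finset V} (hK : Disjoint F K)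
    (hD : Disjoint F D) (hγ : Set.InjOn γ (F ∪ K : Finset V)) : Region G γ (F ∪ K) D := by
  induction F using Finset.induction_on with
  | empty => simpa using h
  | insert v F hvF ih =>
    rw [disjoint_insert_left] at hK hD
    rw [insert_union] at hγ ⊢
    refine (ih hK.2 hD.2 (hγ.mono (by exact_mod_cast subset_insert _ _))).introduce hD.1
      fun y hy hyv => ?_
    have := hγ (mem_coe.2 (mem_insert_of_mem hy)) (mem_coe.2 (mem_insert_self _ _)) hyv
    subst this
    rcases mem_union.1 hy with hy | hy
    exacts [hvF hy, hK.1 hy]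

end Regions

/-! ### From a tree decomposition to types and regions -/

section Trees

variable {V N : Type*} {G : SimpleGraph V}

/-- To prove a property of the set of all nodes of a tree decomposition, it suffices to prove it
for single nodes and to show that it is preserved when a new node `l` is attached to a node `u`,
where the bag of `u` contains all vertices that the bag of `l` has in common with older bags. -/
theorem TreeDecomposition.node_induction [Fintype N] [DecidableEq N] (T : TreeDecomposition G N)
    {P : Finset N → Prop} (single : ∀ u, P {u})
    (attach : ∀ (A : Finset N) (l u : N), l ∉ A → u ∈ A →
      (∀ x, ∀ w ∈ A, x ∈ T.bag l → x ∈ T.bag w → x ∈ T.bag u) → P A → P (insert l A)) :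
    P univ := by
  have hconn := T.isTree.connected
  have hne : Nonempty N := hconn.nonempty
  have key : ∀ n < Fintype.card N, ∃ A : Finset N, #A = n + 1 ∧ P A ∧
      ∀ u ∈ A, ∀ w ∈ A, ∃ q : T.tree.Walk u w, ∀ x ∈ q.support, x ∈ A := by
    intro n hn
    induction n with
    | zero =>
      obtain ⟨u⟩ := hne
      refine ⟨{u}, card_singleton u, single u, fun v hv w hw => ?_⟩
      rw [mem_singleton] at hv hw
      subst hv hw
      exact ⟨.nil, by simp⟩
    | succ n ih =>
      obtain ⟨A, hA, hPA, hw⟩ := ih (by omega)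
      obtain ⟨a, ha⟩ : A.Nonempty := card_pos.1 (by omega)
      obtain ⟨b, hb⟩ : ∃ b, b ∉ A := by
        by_contra! hall
        rw [eq_univ_iff_forall.2 hall, card_univ] at hA
        omega
      obtain ⟨q⟩ := hconn.preconnected a b
      obtain ⟨d, -, hd₁, hd₂⟩ := q.exists_boundary_dart (A : Set N) ha hb
      obtain ⟨⟨u, l⟩, hul⟩ := d
      simp only [mem_coe] at hd₁ hd₂
      have hul' : T.tree.Adj l u := hul.symm
      have hwalk : ∀ w ∈ A, ∃ r : T.tree.Walk u w, ∀ x ∈ r.support, x ∈ A := hw u hd₁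
      refine ⟨insert l A, by rw [card_insert_of_notMem hd₂, hA], ?_, fun x hx y hy => ?_⟩
      · refine attach A l u hd₂ hd₁ (fun x w hwA hxl hxw => ?_) hPA
        obtain ⟨r, hr⟩ := hwalk w hwA
        classical
        -- In a tree, this path from `l` through `u` to `w` is the only one, so it coincides with a
        -- path inside the subtree of nodes containing `x`; hence `x` is in the bag of `u`.
        have hrp : (SimpleGraph.Walk.cons hul' r.bypass).IsPath :=
          r.bypass_isPath.cons fun h => hd₂ (hr l (r.support_bypass_subset_support h))
        obtain ⟨s⟩ := (T.connected_nodes x).preconnected ⟨l, hxl⟩ ⟨w, hxw⟩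
        let e := (SimpleGraph.Embedding.induce (G := T.tree) {u : N | x ∈ T.bag u})
        have hsp : (s.bypass.map e.toHom).IsPath :=
          s.bypass_isPath.map e.injective
        have heq := congrArg Subtype.val
          ((T.isTree.isAcyclic.subsingleton_path l w).elim ⟨_, hrp⟩ ⟨_, hsp⟩)
        have hu : u ∈ (s.bypass.map e.toHom).support := by
          have h1 : u ∈ (SimpleGraph.Walk.cons hul' r.bypass).support := by simp
          simp only at heq
          rw [heq] at h1
          exact h1
        rw [SimpleGraph.Walk.support_map, List.mem_map] at hu
        obtain ⟨z, -, hz⟩ := hu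
        have := z.2
        rw [← hz]
        exact this
      · rcases mem_insert.1 hx with rfl | hxA <;> rcases mem_insert.1 hy with rfl | hyA
        · exact ⟨.nil, by simp⟩
        · obtain ⟨r, hr⟩ := hwalk y hyA
          refine ⟨.cons hul' r, fun z hz => ?_⟩
          rw [SimpleGraph.Walk.support_cons, List.mem_cons] at hz
          rcases hz with rfl | hz
          exacts [mem_insert_self _ _, mem_insert_of_mem (hr z hz)]
        · obtain ⟨r, hr⟩ := hwalk x hxA
          refine ⟨(SimpleGraph.Walk.cons hul' r).reverse, fun z hz => ?_⟩
          rw [SimpleGraph.Walk.support_reverse, List.mem_reverse,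
            SimpleGraph.Walk.support_cons, List.mem_cons] at hz
          rcases hz with rfl | hz
          exacts [mem_insert_self _ _, mem_insert_of_mem (hr z hz)]
        · obtain ⟨r, hr⟩ := hw x hxA y hyA
          exact ⟨r, fun z hz => mem_insert_of_mem (hr z hz)⟩
  have hpos : 0 < Fintype.card N := Fintype.card_pos
  obtain ⟨A, hA, hPA, -⟩ := key (Fintype.card N - 1) (by omega)
  rwa [← eq_univ_of_card A (by omega)]

/-- The vertices can be given types such that the vertices of every bag have distinct types. -/
theorem TreeDecomposition.exists_injOn_bag [Fintype N] {Λ : Type*} [Fintype Λ]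
    (T : TreeDecomposition G N) (hbag : ∀ u, #(T.bag u) ≤ Fintype.card Λ) :
    ∃ γ : V → Λ, ∀ u, Set.InjOn γ (T.bag u) := by
  classical
  obtain ⟨f₀⟩ : Nonempty (V → Λ) := by
    rcases isEmpty_or_nonempty V with hV | ⟨⟨x⟩⟩
    · exact ⟨isEmptyElim⟩
    · obtain ⟨u, hu⟩ := (T.connected_nodes x).nonempty
      have := (card_pos.2 ⟨x, hu⟩).trans_le (hbag u)
      have := Fintype.card_pos_iff.1 this
      exact inferInstance
  suffices ∃ γ : V → Λ, ∀ u ∈ (univ : Finset N), Set.InjOn γ (T.bag u) by simpa using this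
  refine T.node_induction (P := fun A => ∃ γ : V → Λ, ∀ u ∈ A, Set.InjOn γ (T.bag u))
    (fun u => ?_) fun A l u hl hu hlu => ?_
  · obtain ⟨γ, -, hγ⟩ := exists_injOn_extension ∅ (T.bag u) (empty_subset _) f₀ (by simp) (hbag u)
    exact ⟨γ, by simpa using hγ⟩
  · rintro ⟨γ, hγ⟩
    -- Only vertices of the new bag outside the bag of `u` get new types, and these occur in no
    -- older bag.
    obtain ⟨γ', hγ', hinj⟩ := exists_injOn_extension (T.bag l ∩ T.bag u) (T.bag l)
      inter_subset_left γ ((hγ u hu).mono (by simp)) (hbag l)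
    refine ⟨γ', fun w hw => ?_⟩
    rcases mem_insert.1 hw with rfl | hw
    · exact hinj
    · refine (hγ w hw).congr fun x hx => (hγ' x ?_).symm
      by_cases hxl : x ∈ T.bag l
      · exact Or.inl (mem_inter.2 ⟨hxl, hlu x w hw hxl hx⟩)
      · exact Or.inr hxl

theorem TreeDecomposition.region_univ [Fintype V] [DecidableEq V] [Fintype N] {Λ : Type*}
    (T : TreeDecomposition G N) {γ : V → Λ} (hγ : ∀ u, Set.InjOn γ (T.bag u)) :
    Region G γ ∅ univ := by
  classical
  -- Node induction grows a subtree, whereas regions are merged by pruning leaves. The property of a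
  -- subtree is therefore an implication for all families `D` with a fixed conclusion: a leaf is
  -- absorbed into the region of its neighbor, and the hypothesis for the smaller subtree is applied
  -- to the modified family. The edge condition concerns only ends still present in bags, the other
  -- vertices being already forgotten.
  suffices H : ∀ D : N → Finset V, (∀ u ∈ (univ : Finset N), Region G γ (T.bag u) (D u)) →
      (∀ u ∈ (univ : Finset N), ∀ w ∈ (univ : Finset N), u ≠ w → Disjoint (D u) (D w)) →
      (∀ u ∈ (univ : Finset N), ∀ w ∈ (univ : Finset N), Disjoint (D u) (T.bag w)) →
      (∀ x, ∃ u ∈ (univ : Finset N), x ∈ T.bag u ∨ x ∈ D u) →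
      (∀ x y, G.Adj x y → ∀ u ∈ (univ : Finset N), ∀ w ∈ (univ : Finset N), x ∈ T.bag u →
        y ∈ T.bag w → ∃ z ∈ (univ : Finset N), x ∈ T.bag z ∧ y ∈ T.bag z) →
      Region G γ ∅ univ by
    refine H (fun _ => ∅) (fun u _ => .leaf (hγ u)) (by simp) (by simp) (fun x => ?_)
      fun x y hxy _ _ _ _ _ _ => ?_
    · obtain ⟨u, hu⟩ := (T.connected_nodes x).nonempty
      exact ⟨u, mem_univ u, Or.inl hu⟩
    · obtain ⟨u, hu⟩ := T.exists_bag_of_adj x y hxy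
      exact ⟨u, mem_univ u, hu⟩
  refine T.node_induction (P := fun A => ∀ D : N → Finset V,
    (∀ u ∈ A, Region G γ (T.bag u) (D u)) →
    (∀ u ∈ A, ∀ w ∈ A, u ≠ w → Disjoint (D u) (D w)) →
    (∀ u ∈ A, ∀ w ∈ A, Disjoint (D u) (T.bag w)) →
    (∀ x, ∃ u ∈ A, x ∈ T.bag u ∨ x ∈ D u) →
    (∀ x y, G.Adj x y → ∀ u ∈ A, ∀ w ∈ A, x ∈ T.bag u →
      y ∈ T.bag w → ∃ z ∈ A, x ∈ T.bag z ∧ y ∈ T.bag z) →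
    Region G γ ∅ univ) (fun u D hD _ _ hcover _ => ?_)
    fun A l u hl hu hlu ih D hD hDD hDB hcover hedge => ?_
  · simp only [mem_singleton, exists_eq_left, forall_eq] at hD hcover
    have := hD.forget_of_subset (F := T.bag u) Subset.rfl fun _ _ x _ => hcover x
    rwa [sdiff_self, eq_univ_iff_forall.2 fun x => mem_union.2 (hcover x)] at this
  · have hlA : l ∈ insert l A := mem_insert_self l A
    have huA : u ∈ insert l A := mem_insert_of_mem hu
    have hule : u ≠ l := fun h => hl (h ▸ hu)
    set E := (T.bag l \ T.bag u) ∪ D l with hE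
    -- the region of `l`, transferred to the bag of `u`
    have hregE : Region G γ (T.bag u) E := by
      have h1 := (hD l hlA).forget_of_subset (F := T.bag l \ T.bag u) sdiff_subset (by
        intro v hv y hvy
        obtain ⟨hvl, hvu⟩ := mem_sdiff.1 hv
        -- A vertex of the leaf bag missing from the bag of `u` is in no other remaining bag, so its
        -- neighbors lie in the leaf bag or in `D l`, and it can be forgotten.
        have honly : ∀ w ∈ insert l A, v ∈ T.bag w → w = l := fun w hw hvw => by
          rcases mem_insert.1 hw with rfl | hw
          · rfl
          · exact absurd (hlu v w hw hvl hvw) hvu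
        obtain ⟨w, hw, hyw | hyw⟩ := hcover y
        · obtain ⟨z, hz, hvz, hyz⟩ := hedge v y hvy l hlA w hw hvl hyw
          exact Or.inl (honly z hz hvz ▸ hyz)
        · have hvw := ((hD w hw).isSeparated.closed y hyw v hvy.symm).resolve_right
            fun h => disjoint_left.1 (hDB w hw l hlA) h hvl
          exact Or.inr (honly w hw hvw ▸ hyw))
      have h2 : (T.bag u \ T.bag l) ∪ (T.bag l \ (T.bag l \ T.bag u)) = T.bag u := by
        ext x; simp only [mem_union, mem_sdiff]; tauto
      have h3 := h1.introduce_of_injOn (F := T.bag u \ T.bag l)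
        (disjoint_left.2 fun x hx hx' => (mem_sdiff.1 hx).2 (mem_sdiff.1 hx').1)
        (disjoint_left.2 fun x hx hx' => (mem_union.1 hx').elim
          (fun h => (mem_sdiff.1 hx).2 (mem_sdiff.1 h).1)
          fun h => disjoint_left.1 (hDB l hlA u huA) h (mem_sdiff.1 hx).1)
        (by rw [h2]; exact hγ u)
      rwa [h2] at h3
    have hEbag : ∀ w ∈ A, Disjoint E (T.bag w) := fun w hw => disjoint_left.2 fun x hx hxw => by
      rcases mem_union.1 hx with hx | hx
      · exact (mem_sdiff.1 hx).2 (hlu x w hw (mem_sdiff.1 hx).1 hxw)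
      · exact disjoint_left.1 (hDB l hlA w (mem_insert_of_mem hw)) hx hxw
    have hED : ∀ w ∈ A, Disjoint E (D w) := fun w hw => disjoint_left.2 fun x hx hxw => by
      rcases mem_union.1 hx with hx | hx
      · exact disjoint_left.1 (hDB w (mem_insert_of_mem hw) l hlA) hxw (mem_sdiff.1 hx).1
      · exact disjoint_left.1 (hDD l hlA w (mem_insert_of_mem hw) fun h => hl (h ▸ hw)) hx hxw
    have hself : Function.update D u (D u ∪ E) u = D u ∪ E := Function.update_self ..
    have hother : ∀ w, w ≠ u → Function.update D u (D u ∪ E) w = D w := fun w hw =>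
      Function.update_of_ne hw ..
    refine ih (Function.update D u (D u ∪ E)) (fun w hw => ?_) (fun w hw w' hw' hww' => ?_)
      (fun w hw w' hw' => ?_) (fun x => ?_) fun x y hxy w hw w' hw' hxw hyw' => ?_
    · rcases eq_or_ne w u with rfl | hwu
      · rw [hself]
        exact (hD w huA).join hregE (hED w hu).symm
      · rw [hother w hwu]
        exact hD w (mem_insert_of_mem hw)
    · have hDD' := hDD w (mem_insert_of_mem hw) w' (mem_insert_of_mem hw') hww'
      rcases eq_or_ne w u with rfl | hwu
      · rw [hself, hother w' hww'.symm]
        exact disjoint_union_left.2 ⟨hDD', hED w' hw'⟩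
      · rw [hother w hwu]
        rcases eq_or_ne w' u with rfl | hwu'
        · rw [hself]
          exact disjoint_union_right.2 ⟨hDD', (hED w hw).symm⟩
        · rwa [hother w' hwu']
    · have hDB' := hDB w (mem_insert_of_mem hw) w' (mem_insert_of_mem hw')
      rcases eq_or_ne w u with rfl | hwu
      · rw [hself]
        exact disjoint_union_left.2 ⟨hDB', hEbag w' hw'⟩
      · rwa [hother w hwu]
    · obtain ⟨w, hw, hxw⟩ := hcover x
      rcases mem_insert.1 hw with rfl | hw
      · refine ⟨u, hu, ?_⟩
        rw [hself]
        simp only [hE, mem_union, mem_sdiff]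
        tauto
      · refine ⟨w, hw, hxw.imp_right fun h => ?_⟩
        rcases eq_or_ne w u with rfl | hwu
        · rw [hself]; exact mem_union_left _ h
        · rwa [hother w hwu]
    · obtain ⟨z, hz, hxz, hyz⟩ := hedge x y hxy w (mem_insert_of_mem hw) w'
        (mem_insert_of_mem hw') hxw hyw'
      rcases mem_insert.1 hz with rfl | hz
      · exact ⟨u, hu, hlu x w hw hxz hxw, hlu y w' hw' hyz hyw'⟩
      · exact ⟨z, hz, hxz, hyz⟩

end Trees

/-! ### Conclusion: two colorings meet in a common form -/

theorem theorem2 {V : Type*} [Fintype V] (G : SimpleGraph V) (k : ℕ)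
    (hk : treewidth G + 2 ≤ (k : ℤ)) :
    IsMixing G k ∧
      recoloringDiameter G k ≤ ((2 * (Fintype.card V ^ 2 + Fintype.card V) : ℕ) : ℕ∞) := by
  classical
  obtain ⟨m, T, hT⟩ := (treewidth_isLeast G).1
  set b := Finset.univ.sup fun u => (T.bag u).card with hb
  have hbk : b < k := by
    have : ((b : ℕ) : ℤ) - 1 = treewidth G := hT
    omega
  have hC : Fintype.card (Fin b) < k := by simpa using hbk
  obtain ⟨γ, hγ⟩ := T.exists_injOn_bag (Λ := Fin b) fun u => by
    rw [Fintype.card_fin]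
    exact le_sup (f := fun u => (T.bag u).card) (mem_univ u)
  have hproper : ∀ x y, G.Adj x y → γ x ≠ γ y := fun x y hxy h => by
    obtain ⟨u, hxu, hyu⟩ := T.exists_bag_of_adj x y hxy
    exact hxy.ne (hγ u hxu hyu h)
  -- With an empty bag and all vertices forgotten, the form reached depends on the initial coloring
  -- only through its palette.
  obtain ⟨O, hS, hO, hreach⟩ := (T.region_univ hγ).exists_edist_le hproper hC
  have hdist : ∀ f g : G.Coloring (Fin k), (recoloringGraph G k).edist f g ≤
      ((2 * (Fintype.card V ^ 2 + Fintype.card V) : ℕ) : ℕ∞) := by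
    intro f g
    obtain ⟨p, hp, hf⟩ := hreach f
    obtain ⟨q, hq, hg⟩ := hreach g
    have hq' : IsPalette γ ∅ f q := hq.congr (by simp)
    have heq : slotColoring hproper hS hO f hq' = slotColoring hproper hS hO g hq := by
      ext x
      rw [slotColoring_apply, slotColoring_apply, slotColor_of_mem (mem_univ x),
        slotColor_of_mem (mem_univ x), slot_congr (by simp) rfl]
    have hpq := edist_slotColoring_le hproper hS hO f hC hp hq'
    rw [heq] at hpq
    rw [SimpleGraph.edist_comm] at hg
    refine (SimpleGraph.edist_triangle.trans (add_le_add hf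
      (SimpleGraph.edist_triangle.trans (add_le_add hpq hg)))).trans ?_
    rw [← Nat.cast_add, ← Nat.cast_add, Nat.cast_le, card_univ, card_empty]
    -- The three paths have lengths at most n(n + 0), 2n and n(n + 0).
    exact le_of_eq (by ring)
  refine ⟨?_, ?_⟩
  · have : Nonempty (G.Coloring (Fin k)) :=
      ⟨SimpleGraph.Coloring.mk (fun x => Fin.castLE hbk.le (γ x)) fun {x y} h heq =>
        hproper x y h (Fin.castLE_injective hbk.le heq)⟩
    refine ⟨fun f g => ?_⟩
    exact SimpleGraph.reachable_of_edist_ne_top ((hdist f g).trans_lt (ENat.natCast_lt_top _)).ne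
  · exact SimpleGraph.ediam_le_of_edist_le hdist
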